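/- An expansion of a real number $x$ in base $q>1$ is a sequence $(c_i)_{i\ge1}$ of integers with $0\le c_i<q$ for all $i$ and $x=\sum_{i\ge1}c_iq^{-i}$. Sequences are ordered lexicographically. The quasi-greedy expansion of $x$ in base $q$ is its largest expansion with infinitely many nonzero digits if $x\neq0$, and $0^\infty$ if $x=0$; it exists for every $x\in J_q:=[0,(\lceil q\rceil-1)/(q-1)]$. Let $(\alpha_i)=(\alpha_i(q))$ be the quasi-greedy expansion of $1$ in base $q$, and write $\overline{c_1c_2\ldots}:=(\alpha_1-c_1)(\alpha_1-c_2)\ldots$ for sequences of digits $c_i\in\{0,\ldots,\alpha_1\}$. Let $\mathcal U_q$ be the set of $x$ having exactly one expansion in base $q$, and let $\mathcal V_q$ be the set of $x\in J_q$ whose quasi-greedy expansion $(a_i)$ in base $q$ satisfies $\overline{a_{n+1}a_{n+2}\ldots}\le\alpha_1\alpha_2\ldots$ whenever $a_n>0$. Let $\mathcal U_q'$ and $\mathcal V_q'$ be the sets of quasi-greedy expansions in base $q$ of the elements of $\mathcal U_q$ and of $\mathcal V_q$, respectively. Let $\mathcal U$ be the set of $q>1$ with $1\in\mathcal U_q$,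 let $\overline{\mathcal U}$ be its closure in $\mathbb R$, and let $\mathcal V$ be the set of $q>1$ such that $\overline{\alpha_{k+1}(q)\alpha_{k+2}(q)\ldots}\le\alpha_1(q)\alpha_2(q)\ldots$ for all $k\ge1$. A stability interval is an interval $I\subset(1,\infty)$ such that $\mathcal U_q'=\mathcal U_s'$ for all $q,s\in I$; it is maximal if no stability interval strictly contains it. Theorem. The maximal stability intervals are exactly the singletons $\{q\}$ with $q\in\overline{\mathcal U}$ and the intervals $(q_1,q_2]$ where $(q_1,q_2)$ is a connected component of $(1,\infty)\setminus\mathcal V$. Moreover, if $(q_1,q_2)$ is such a component and $q_1\in\mathcal V\setminus\mathcal U$, then $\mathcal U_q'=\mathcal V_{q_1}'$ for all $q\in(q_1,q_2]$. -/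

import Mathlib

namespace Expansions

open Set

/-- `c` is an expansion of `x` in base `q`: digits are integers in `[0, q)` and `x = ∑ cᵢ q⁻ⁱ`.
Sequences are indexed from `0`, so `c i` is the digit usually written `c_{i+1}`. -/
def IsExpansion (q x : ℝ) (c : ℕ → ℕ) : Prop :=
  (∀ i, (c i : ℝ) < q) ∧ HasSum (fun i => (c i : ℝ) / q ^ (i + 1)) x

/-- The sequence has infinitely many nonzero elements. -/
def IsInfinite (c : ℕ → ℕ) : Prop := {i | c i ≠ 0}.Infinite

/-- Non-strict lexicographic order on sequences. -/
def LexLE (a b : ℕ → ℕ) : Prop := toLex a ≤ toLex b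

/-- `a` is the quasi-greedy expansion of `x` in base `q`: the lexicographically largest infinite
expansion of `x` if `x ≠ 0`, and the zero sequence if `x = 0`. -/
def IsQuasiGreedy (q x : ℝ) (a : ℕ → ℕ) : Prop :=
  (x = 0 ∧ a = 0) ∨
  (x ≠ 0 ∧ IsExpansion q x a ∧ IsInfinite a ∧
    ∀ c, IsExpansion q x c → IsInfinite c → LexLE c a)

/-- Digitwise conjugate with respect to the largest digit `m`; it is only applied to sequences
with digits at most `m`, where the subtraction is not truncated. -/
def conj (m : ℕ) (c : ℕ → ℕ) : ℕ → ℕ := fun i => m - c i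

/-- The sequence with its first `k` elements removed. -/
def shift (k : ℕ) (c : ℕ → ℕ) : ℕ → ℕ := fun i => c (k + i)

/-- The interval `J_q = [0, (⌈q⌉ - 1) / (q - 1)]`. -/
def J (q : ℝ) : Set ℝ := Icc 0 (((⌈q⌉ : ℝ) - 1) / (q - 1))

/-- `𝒰_q`: the numbers with exactly one expansion in base `q`. -/
def Uq (q : ℝ) : Set ℝ := {x | ∃! c, IsExpansion q x c}

/-- `𝒱_q`: the `x ∈ J_q` whose quasi-greedy expansion `a` satisfies
`conj (a_{n+1} a_{n+2} …) ≤ α` whenever `a_n > 0`, where `α` is the quasi-greedy expansion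
of `1` in base `q`. -/
def Vq (q : ℝ) : Set ℝ :=
  {x | x ∈ J q ∧ ∃ α a, IsQuasiGreedy q 1 α ∧ IsQuasiGreedy q x a ∧
    ∀ n, 0 < a n → LexLE (conj (α 0) (shift (n + 1) a)) α}

/-- `𝒰_q'`: the quasi-greedy expansions in base `q` of the elements of `𝒰_q`. -/
def Uq' (q : ℝ) : Set (ℕ → ℕ) := {a | ∃ x ∈ Uq q, IsQuasiGreedy q x a}

/-- `𝒱_q'`: the quasi-greedy expansions in base `q` of the elements of `𝒱_q`. -/
def Vq' (q : ℝ) : Set (ℕ → ℕ) := {a | ∃ x ∈ Vq q, IsQuasiGreedy q x a}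

/-- `𝒰`: the univoque bases `q > 1`, for which `1` has exactly one expansion. -/
def U : Set ℝ := {q | 1 < q ∧ (1 : ℝ) ∈ Uq q}

/-- `𝒱`: the `q > 1` for which the quasi-greedy expansion `α` of `1` in base `q` satisfies
`conj (α_{k+1} α_{k+2} …) ≤ α` for all `k ≥ 1`. -/
def V : Set ℝ :=
  {q | 1 < q ∧ ∃ α, IsQuasiGreedy q 1 α ∧ ∀ k, 1 ≤ k → LexLE (conj (α 0) (shift k α)) α}

/-- `(q₁, q₂)` is a connected component of `(1, ∞) \ 𝒱`. -/
def IsVGap (q₁ q₂ : ℝ) : Prop :=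
  ∃ x ∈ Ioi (1 : ℝ) \ V, connectedComponentIn (Ioi (1 : ℝ) \ V) x = Ioo q₁ q₂

/-- `I ⊆ (1, ∞)` is an interval on which `q ↦ 𝒰_q'` is constant. -/
def IsStabilityInterval (I : Set ℝ) : Prop :=
  I.OrdConnected ∧ I ⊆ Ioi 1 ∧ ∀ q ∈ I, ∀ s ∈ I, Uq' q = Uq' s

end Expansions

/-!
Write `α(q)` for the quasi-greedy expansion of `1` in base `q` and `m = ⌈q⌉ - 1` for the largest
digit.

Everything is translated into the lexicographic order. The map `q ↦ α(q)` is strictly increasing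
(`alpha_lt_alpha`), and its image consists of the infinite sequences that no tail of theirs exceeds
(`isParry_alpha`, `IsParry.exists_alpha_eq`). A sequence is univoque in base `q` if and only if each
tail after a digit below `m`, and the conjugate of each tail after a nonzero digit, is smaller than
`α(q)` (`mem_Uq'_iff`); for `𝒱_q'` the inequalities are weak (`mem_Vq'_iff`).

The elements of `V` are of two kinds. If the conjugates of all proper tails of `α(q)` are strictly
smaller than `α(q)`, then `V` accumulates at `q` from the left (`exists_mem_V_lt`), and so does `U`
unless `q ∈ U` (`exists_mem_U_le`). Otherwise `α(q) = (w w̄)^∞`, and `q` is isolated in `V`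
(`exists_isolating`). Hence the bases of the first kind form `closure U` (`closure_U_eq`). Moreover,
`V` is closed (`isClosed_V`), by compactness of the space of sequences with bounded digits.

The main step is `Uq'_eq_iff`: for `q < s` the equality `𝒰_q' = 𝒰_s'` holds if and only if
`[q, s)` does not meet `V`. If `r ∈ V ∩ [q, s)`, then the sequence `0 α(r)` (or the constant sequence
of largest digits, if `⌈q⌉ < ⌈s⌉`) is univoque in base `s` but not in base `q`. Conversely, let `c`
be univoque in base `s` and not in base `q`, and let `g` be the supremum of the tails and conjugate
tails of `c` that are compared with `α(s)`. Then `g = α(r)` for some `r ∈ V` with `q ≤ r ≤ s`.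
If `r = s`, then the supremum is not attained; this is impossible for `α(s) = (w w̄)^∞`, and otherwise
`V` accumulates at `s` from the left (`exists_mem_V_of_mem_tails`).

Hence the maximal stability intervals are the classes of the relation "`V` does not meet `[q, s)`":
the class of a point of `closure U` is a singleton, and every other point lies in `(q₁, q₂]` for a gap
`(q₁, q₂)` of `V` (`exists_isVGap`). The same supremum shows that the tails of a univoque sequence in
a base of `(q₁, q₂]` are at most `α(q₁)`, which is the second assertion.
-/

namespace Expansions

open Set Filter Topology

/-! ### The lexicographic order -/

theorem toLex_lt_iff {a b : ℕ → ℕ} :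
    toLex a < toLex b ↔ ∃ i, (∀ j < i, a j = b j) ∧ a i < b i := Iff.rfl

@[simp] theorem shift_shift (k l : ℕ) (c : ℕ → ℕ) : shift k (shift l c) = shift (l + k) c := by
  funext i; simp [shift, add_assoc]

@[simp] theorem shift_zero (c : ℕ → ℕ) : shift 0 c = c := by
  funext i; simp [shift]

theorem shift_apply_le {m : ℕ} {c : ℕ → ℕ} (hc : ∀ i, c i ≤ m) (k i : ℕ) : shift k c i ≤ m := hc _

theorem shift_conj (k m : ℕ) (c : ℕ → ℕ) : shift k (conj m c) = conj m (shift k c) := rfl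

theorem conj_le (m : ℕ) (c : ℕ → ℕ) (i : ℕ) : conj m c i ≤ m := Nat.sub_le _ _

theorem conj_conj {m : ℕ} {c : ℕ → ℕ} (hc : ∀ i, c i ≤ m) : conj m (conj m c) = c := by
  funext i
  have := hc i
  simp only [conj]; omega

theorem conj_lt_conj {m : ℕ} {a b : ℕ → ℕ} (ha : ∀ i, a i ≤ m) (hb : ∀ i, b i ≤ m) :
    toLex (conj m a) < toLex (conj m b) ↔ toLex b < toLex a := by
  simp only [toLex_lt_iff, conj]
  refine exists_congr fun i => ?_
  have h1 := ha i
  have h2 := hb i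
  refine and_congr (forall₂_congr fun j _ => ?_) (by omega)
  have h1 := ha j
  have h2 := hb j
  omega

theorem conj_le_conj {m : ℕ} {a b : ℕ → ℕ} (ha : ∀ i, a i ≤ m) (hb : ∀ i, b i ≤ m) :
    toLex (conj m a) ≤ toLex (conj m b) ↔ toLex b ≤ toLex a := by
  exact not_lt.symm.trans ((not_congr (conj_lt_conj hb ha)).trans not_lt)

theorem shift_lt_shift {a b : ℕ → ℕ} {n : ℕ} (h : ∀ j < n, a j = b j) (hab : toLex a < toLex b) :
    toLex (shift n a) < toLex (shift n b) := by
  obtain ⟨i, hi, hlt⟩ := toLex_lt_iff.1 hab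
  have hn : n ≤ i := by
    by_contra! hin
    exact hlt.ne (h i hin)
  refine toLex_lt_iff.2 ⟨i - n, fun j hj => hi _ (by omega), ?_⟩
  simp only [shift]
  rwa [Nat.add_sub_cancel' hn]

theorem lt_of_shift_lt {a b : ℕ → ℕ} {n : ℕ} (h : ∀ j < n, a j = b j)
    (hab : toLex (shift n a) < toLex (shift n b)) : toLex a < toLex b := by
  obtain ⟨i, hi, hlt⟩ := toLex_lt_iff.1 hab
  refine toLex_lt_iff.2 ⟨n + i, fun j hj => ?_, hlt⟩
  by_cases hjn : j < n
  · exact h j hjn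
  · have := hi (j - n) (by omega)
    simp only [shift] at this
    rwa [Nat.add_sub_cancel' (by omega)] at this

/-- Deleting a leading maximal digit does not increase a sequence. -/
theorem shift_succ_le {m : ℕ} {c : ℕ → ℕ} (hc : ∀ i, c i ≤ m) {k : ℕ} (hk : c k = m) :
    toLex (shift (k + 1) c) ≤ toLex (shift k c) := by
  by_contra! h
  obtain ⟨i, hi, hlt⟩ := toLex_lt_iff.1 h
  have key : ∀ j ≤ i, c (k + j) = m := by
    intro j
    induction j with
    | zero => simpa using hk
    | succ j ih =>
      intro hj
      have h1 := hi j (by omega)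
      have h2 := ih (by omega)
      simp only [shift] at h1
      rw [show k + (j + 1) = k + 1 + j by ring, ← h1, h2]
  have h1 := key i le_rfl
  have h2 := hc (k + 1 + i)
  simp only [shift] at hlt
  omega

/-- A bounded set of sequences has a lexicographic supremum, which its elements approximate
digitwise. -/
theorem exists_lex_sup {D : Set (ℕ → ℕ)} {m : ℕ} (hD : ∀ d ∈ D, ∀ i, d i ≤ m)
    (hne : D.Nonempty) :
    ∃ g : ℕ → ℕ, (∀ d ∈ D, toLex d ≤ toLex g) ∧ ∀ n, ∃ d ∈ D, ∀ j < n, d j = g j := by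
  have step : ∀ (n : ℕ) (d : D), ∃ e : D, (∀ j < n, e.1 j = d.1 j) ∧
      ∀ f ∈ D, (∀ j < n, f j = d.1 j) → f n ≤ e.1 n := by
    intro n d
    have hfin : {k | ∃ e ∈ D, (∀ j < n, e j = d.1 j) ∧ e n = k}.Finite :=
      (Set.finite_Iic m).subset (by rintro k ⟨e, he, -, rfl⟩; exact hD e he n)
    obtain ⟨k, ⟨e, he, hej, rfl⟩, hmax⟩ := hfin.exists_maximalFor id _ ⟨_, d.1, d.2, by simp, rfl⟩
    refine ⟨⟨e, he⟩, hej, fun f hf hfj => ?_⟩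
    by_contra! hlt
    exact absurd (hmax ⟨f, hf, hfj, rfl⟩ hlt.le) (not_le.2 hlt)
  choose F hF1 hF2 using step
  let s : ℕ → D := fun n => Nat.rec ⟨hne.some, hne.some_mem⟩ F n
  have hs : ∀ n, s (n + 1) = F n (s n) := fun n => rfl
  have agree : ∀ k n, n ≤ k → ∀ j < n, (s k).1 j = (s n).1 j := by
    intro k n hk j hj
    induction k, hk using Nat.le_induction with
    | base => rfl
    | succ k hk ih => rw [hs, hF1 k (s k) j (by omega), ih]
  refine ⟨fun n => (s (n + 1)).1 n, fun d hd => ?_, fun n => ⟨(s n).1, (s n).2, fun j hj =>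
    agree n (j + 1) hj j (by omega)⟩⟩
  by_contra! h
  obtain ⟨i, hi, hlt⟩ := toLex_lt_iff.1 h
  have := hF2 i (s i) d hd fun j hj => by
    rw [← hi j hj]
    exact (agree i (j + 1) hj j (by omega)).symm
  rw [← hs] at this
  exact absurd this (not_le.2 hlt)

/-! ### Values of sequences in a base -/

/-- The number represented by the sequence `c` in base `q`. -/
noncomputable def value (q : ℝ) (c : ℕ → ℕ) : ℝ := ∑' i, (c i : ℝ) / q ^ (i + 1)

section Value

variable {q : ℝ} {m : ℕ} {c : ℕ → ℕ}

theorem hasSum_const (hq : 1 < q) (m : ℕ) :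
    HasSum (fun i : ℕ => (m : ℝ) / q ^ (i + 1)) (m / (q - 1)) := by
  have h := (hasSum_geometric_of_lt_one (r := q⁻¹) (by positivity)
    (inv_lt_one_of_one_lt₀ hq)).mul_left ((m : ℝ) / q)
  have h0 : q ≠ 0 := by positivity
  have h1 : q - 1 ≠ 0 := by linarith
  have e1 : (fun i : ℕ => (m : ℝ) / q ^ (i + 1)) = fun i => (m : ℝ) / q * q⁻¹ ^ i := by
    funext i
    rw [inv_pow, pow_succ]; field_simp
  have e2 : (m : ℝ) / (q - 1) = m / q * (1 - q⁻¹)⁻¹ := by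
    have : (1 - q⁻¹) = (q - 1) / q := by field_simp
    rw [this]; field_simp
  rw [e1, e2]
  exact h

theorem summable_value (hq : 1 < q) (hc : ∀ i, c i ≤ m) :
    Summable fun i => (c i : ℝ) / q ^ (i + 1) := by
  refine Summable.of_nonneg_of_le (fun i => by positivity) (fun i => ?_) (hasSum_const hq m).summable
  have : (c i : ℝ) ≤ m := by exact_mod_cast hc i
  gcongr

theorem hasSum_value (hq : 1 < q) (hc : ∀ i, c i ≤ m) :
    HasSum (fun i => (c i : ℝ) / q ^ (i + 1)) (value q c) := (summable_value hq hc).hasSum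

theorem value_nonneg (hq : 1 < q) (c : ℕ → ℕ) : 0 ≤ value q c :=
  tsum_nonneg fun i => by positivity

theorem value_le (hq : 1 < q) (hc : ∀ i, c i ≤ m) : value q c ≤ m / (q - 1) := by
  refine hasSum_le (fun i => ?_) (hasSum_value hq hc) (hasSum_const hq m)
  have : (c i : ℝ) ≤ m := by exact_mod_cast hc i
  gcongr

theorem value_pos (hq : 1 < q) (hc : ∀ i, c i ≤ m) {i : ℕ} (hi : c i ≠ 0) : 0 < value q c :=
  (summable_value hq hc).tsum_pos (fun i => by positivity) i
    (by have : 0 < c i := by omega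
        positivity)

theorem value_conj (hq : 1 < q) (hc : ∀ i, c i ≤ m) :
    value q (conj m c) = m / (q - 1) - value q c := by
  refine HasSum.tsum_eq ?_
  have e : (fun i => (conj m c i : ℝ) / q ^ (i + 1)) =
      fun i => (m : ℝ) / q ^ (i + 1) - (c i : ℝ) / q ^ (i + 1) := by
    funext i
    have : ((conj m c i : ℕ) : ℝ) = m - c i := Nat.cast_sub (hc i)
    rw [this]; ring
  rw [e]
  exact (hasSum_const hq m).sub (hasSum_value hq hc)

theorem value_eq_sum_add (hq : 1 < q) (hc : ∀ i, c i ≤ m) (n : ℕ) :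
    value q c = ∑ i ∈ Finset.range n, (c i : ℝ) / q ^ (i + 1) + value q (shift n c) / q ^ n := by
  rw [value, ← (summable_value hq hc).sum_add_tsum_nat_add n, value, ← tsum_div_const]
  congr 2
  funext i
  rw [shift, div_div, ← pow_add]
  congr 2 <;> ring_nf

theorem value_shift_succ (hq : 1 < q) (hc : ∀ i, c i ≤ m) (n : ℕ) :
    q * value q (shift n c) = c n + value q (shift (n + 1) c) := by
  have h := value_eq_sum_add hq (c := shift n c) (m := m) (fun i => hc _) 1
  rw [h]
  simp only [shift_shift]
  simp [shift]
  field_simp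

theorem value_sub_of_agree (hq : 1 < q) {a b : ℕ → ℕ} (ha : ∀ i, a i ≤ m) (hb : ∀ i, b i ≤ m)
    {i : ℕ} (h : ∀ j < i, a j = b j) :
    (value q a - value q b) * q ^ (i + 1) =
      (a i + value q (shift (i + 1) a)) - (b i + value q (shift (i + 1) b)) := by
  rw [← value_shift_succ hq ha, ← value_shift_succ hq hb, value_eq_sum_add hq ha i,
    value_eq_sum_add hq hb i, Finset.sum_congr rfl fun j hj => by rw [h j (Finset.mem_range.1 hj)]]
  field_simp
  ring

theorem IsInfinite.shift {c : ℕ → ℕ} (h : IsInfinite c) (k : ℕ) : IsInfinite (shift k c) := by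
  unfold IsInfinite at *
  rw [Set.infinite_iff_exists_gt] at *
  intro n
  obtain ⟨i, hi, hn⟩ := h (n + k)
  refine ⟨i - k, ?_, by omega⟩
  simp only [Set.mem_ofPred_eq, Expansions.shift] at *
  rwa [Nat.add_sub_cancel' (by omega)]

theorem IsInfinite.exists_ne {c : ℕ → ℕ} (h : IsInfinite c) (k : ℕ) : ∃ i ≥ k, c i ≠ 0 := by
  unfold IsInfinite at *
  rw [Set.infinite_iff_exists_gt] at *
  obtain ⟨i, hi, hn⟩ := h k
  exact ⟨i, hn.le, hi⟩

theorem isInfinite_iff {c : ℕ → ℕ} : IsInfinite c ↔ ∀ k, ∃ i ≥ k, c i ≠ 0 := by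
  refine ⟨fun h => h.exists_ne, fun h => ?_⟩
  unfold IsInfinite
  rw [Set.infinite_iff_exists_gt]
  intro n
  obtain ⟨i, hi, h0⟩ := h (n + 1)
  exact ⟨i, h0, by omega⟩

theorem IsInfinite.value_shift_pos (hq : 1 < q) (h : IsInfinite c) (hc : ∀ i, c i ≤ m) (k : ℕ) :
    0 < value q (Expansions.shift k c) := by
  obtain ⟨i, -, hi⟩ := (h.shift k).exists_ne 0
  exact value_pos hq (fun i => hc _) hi

theorem value_lt_value {r : ℝ} (hq : 1 < q) (hqr : q < r) (hc : ∀ i, c i ≤ m) {i : ℕ}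
    (hi : c i ≠ 0) : value r c < value q c := by
  have h0 : 0 < q := by linarith
  refine (summable_value (hq.trans hqr) hc).tsum_lt_tsum (i := i) (fun j => ?_) ?_
    (summable_value hq hc)
  · gcongr
  · have : 0 < c i := by omega
    gcongr

end Value

/-! ### Quasi-greedy expansions -/

/-- The largest digit `⌈q⌉ - 1` available in base `q`. -/
noncomputable def maxDigit (q : ℝ) : ℕ := ⌈q⌉₊ - 1

section Digits

variable {q : ℝ}

theorem cast_lt_iff (hq : 1 < q) {d : ℕ} : (d : ℝ) < q ↔ d ≤ maxDigit q := by
  rw [maxDigit, ← Nat.lt_ceil]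
  have : 1 < ⌈q⌉₊ := Nat.lt_ceil.2 (by exact_mod_cast hq)
  omega

theorem maxDigit_lt (hq : 1 < q) : (maxDigit q : ℝ) < q := (cast_lt_iff hq).2 le_rfl

theorem le_maxDigit_add_one (hq : 1 < q) : q ≤ maxDigit q + 1 := by
  by_contra! h
  have : ((maxDigit q + 1 : ℕ) : ℝ) < q := by exact_mod_cast h
  rw [cast_lt_iff hq] at this
  omega

theorem one_le_maxDigit (hq : 1 < q) : 1 ≤ maxDigit q :=
  (cast_lt_iff hq).1 (by exact_mod_cast hq)

theorem maxDigit_mono {r : ℝ} (h : q ≤ r) : maxDigit q ≤ maxDigit r :=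
  Nat.sub_le_sub_right (Nat.ceil_mono h) 1

theorem one_le_div (hq : 1 < q) : 1 ≤ (maxDigit q : ℝ) / (q - 1) := by
  rw [le_div_iff₀ (by linarith)]
  linarith [le_maxDigit_add_one hq]

theorem isExpansion_iff (hq : 1 < q) {x : ℝ} {c : ℕ → ℕ} :
    IsExpansion q x c ↔ (∀ i, c i ≤ maxDigit q) ∧ value q c = x := by
  unfold IsExpansion
  simp only [cast_lt_iff hq]
  refine and_congr_right fun h => ⟨fun hs => hs.tsum_eq, ?_⟩
  rintro rfl
  exact hasSum_value hq h

end Digits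

/-- The quasi-greedy algorithm: with remainder `x`, the next digit is the largest `d ≤ m` with
`d < q x`, and the new remainder is `q x - d`. -/
theorem exists_infinite_expansion {q x : ℝ} (hq : 1 < q) (hx : 0 < x)
    (hx' : x ≤ maxDigit q / (q - 1)) :
    ∃ a : ℕ → ℕ, (∀ i, a i ≤ maxDigit q) ∧ IsInfinite a ∧ value q a = x ∧
      ∀ n, a n < maxDigit q → value q (shift (n + 1) a) ≤ 1 := by
  set m := maxDigit q with hm
  have hq0 : 0 < q := by linarith
  have hq1 : 0 < q - 1 := by linarith
  have step : ∀ x : {x : ℝ // 0 < x ∧ x ≤ m / (q - 1)}, ∃ (d : ℕ)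
      (y : {x : ℝ // 0 < x ∧ x ≤ m / (q - 1)}), d ≤ m ∧ y.1 = q * x.1 - d ∧ (d < m → y.1 ≤ 1) := by
    rintro ⟨x, h0, h1⟩
    have hqx : 0 < q * x := by positivity
    by_cases hmx : (m : ℝ) < q * x
    · refine ⟨m, ⟨q * x - m, by linarith, ?_⟩, le_rfl, rfl, fun h => absurd h (lt_irrefl _)⟩
      have : q * x ≤ q * (m / (q - 1)) := by gcongr
      have e : q * (m / (q - 1)) - m = m / (q - 1) := by field_simp; ring
      linarith
    · push Not at hmx
      have hc : 0 < ⌈q * x⌉₊ := Nat.ceil_pos.2 hqx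
      have h2 : ((⌈q * x⌉₊ - 1 : ℕ) : ℝ) < q * x := Nat.lt_ceil.1 (by omega)
      have h3 : q * x - ((⌈q * x⌉₊ - 1 : ℕ) : ℝ) ≤ 1 := by
        rw [Nat.cast_sub (by omega)]
        have := Nat.le_ceil (q * x)
        push_cast; linarith
      refine ⟨⌈q * x⌉₊ - 1, ⟨q * x - ((⌈q * x⌉₊ - 1 : ℕ) : ℝ), by linarith,
        h3.trans (one_le_div hq)⟩, ?_, rfl, fun _ => h3⟩
      have : ⌈q * x⌉₊ ≤ m := Nat.ceil_le.2 hmx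
      omega
  choose d y hd hy hy1 using step
  let X : ℕ → {x : ℝ // 0 < x ∧ x ≤ m / (q - 1)} := fun n => Nat.rec ⟨x, hx, hx'⟩ (fun _ => y) n
  have hX : ∀ n, X (n + 1) = y (X n) := fun n => rfl
  let a : ℕ → ℕ := fun n => d (X n)
  have ha : ∀ i, a i ≤ m := fun i => hd _
  have hsum : ∀ n, x = ∑ i ∈ Finset.range n, (a i : ℝ) / q ^ (i + 1) + (X n).1 / q ^ n := by
    intro n
    induction n with
    | zero => simp [X]
    | succ n ih =>
      rw [Finset.sum_range_succ, hX, hy, ih]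
      simp only [a]
      field_simp
      ring
  have hval : value q a = x := by
    have h1 := (hasSum_value hq ha).tendsto_sum_nat
    have h2 : Tendsto (fun n => (X n).1 / q ^ n) atTop (𝓝 0) := by
      refine squeeze_zero (fun n => div_nonneg (X n).2.1.le (by positivity))
        (g := fun n => m / (q - 1) * (q⁻¹) ^ n) (fun n => ?_) ?_
      · rw [inv_pow, ← div_eq_mul_inv]
        have := (X n).2.2
        gcongr
      · simpa using (tendsto_pow_atTop_nhds_zero_of_lt_one (by positivity)
          (inv_lt_one_of_one_lt₀ hq)).const_mul ((m : ℝ) / (q - 1))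
    have h3 := h1.add h2
    simp only [← hsum, add_zero] at h3
    exact (tendsto_nhds_unique h3 tendsto_const_nhds)
  have hshift : ∀ n, value q (shift n a) = (X n).1 := by
    intro n
    have h1 := value_eq_sum_add hq ha n
    rw [hval] at h1
    have h2 := hsum n
    have hp : (0 : ℝ) < q ^ n := by positivity
    have h3 : value q (shift n a) / q ^ n = (X n).1 / q ^ n := by linarith
    field_simp at h3
    exact h3
  refine ⟨a, ha, isInfinite_iff.2 fun k => ?_, hval, fun n hn => ?_⟩
  · by_contra! h
    have h1 := (X k).2.1
    rw [← hshift k] at h1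
    have : shift k a = fun _ => 0 := funext fun i => h _ (by omega)
    rw [this] at h1
    simp [value] at h1
  · rw [hshift, hX]
    exact hy1 _ hn

theorem exists_expansion {q x : ℝ} (hq : 1 < q) (hx : 0 ≤ x) (hx' : x ≤ maxDigit q / (q - 1)) :
    ∃ a : ℕ → ℕ, (∀ i, a i ≤ maxDigit q) ∧ value q a = x := by
  rcases hx.eq_or_lt with rfl | hx
  · exact ⟨0, fun i => by simp, by simp [value]⟩
  · obtain ⟨a, ha, -, hv, -⟩ := exists_infinite_expansion hq hx hx'
    exact ⟨a, ha, hv⟩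

theorem lexLE_iff {a b : ℕ → ℕ} : LexLE a b ↔ toLex a ≤ toLex b := Iff.rfl

theorem IsQuasiGreedy.unique {q x : ℝ} {a b : ℕ → ℕ} (ha : IsQuasiGreedy q x a)
    (hb : IsQuasiGreedy q x b) : a = b := by
  rcases ha with ⟨h0, rfl⟩ | ⟨hx, h1, h2, h3⟩ <;> rcases hb with ⟨h0', rfl⟩ | ⟨hx', h1', h2', h3'⟩
  · rfl
  · exact absurd h0 hx'
  · exact absurd h0' hx
  · exact toLex.injective (le_antisymm (h3' a h1 h2) (h3 b h1' h2'))

section QuasiGreedy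

variable {q x : ℝ} {a : ℕ → ℕ}

theorem isQuasiGreedy_of_value (hq : 1 < q) (ha : ∀ i, a i ≤ maxDigit q) (hinf : IsInfinite a)
    (h : ∀ n, a n < maxDigit q → value q (shift (n + 1) a) ≤ 1) :
    IsQuasiGreedy q (value q a) a := by
  have hpos : 0 < value q a := by simpa using hinf.value_shift_pos hq ha 0
  refine Or.inr ⟨hpos.ne', (isExpansion_iff hq).2 ⟨ha, rfl⟩, hinf, fun c hc hci => ?_⟩
  obtain ⟨hc, hcv⟩ := (isExpansion_iff hq).1 hc
  rw [lexLE_iff]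
  by_contra! hlt
  obtain ⟨i, hi, hlt⟩ := toLex_lt_iff.1 hlt
  have h1 := value_sub_of_agree hq ha hc hi
  rw [hcv, sub_self, zero_mul] at h1
  have h2 := h i (hlt.trans_le (hc i))
  have h3 := hci.value_shift_pos hq hc (i + 1)
  have h4 : (a i : ℝ) + 1 ≤ c i := by exact_mod_cast hlt
  linarith

/-- Among infinite sequences with digits at most `⌈q⌉ - 1`, the quasi-greedy ones are those whose
remainder after every non-maximal digit is at most `1`. -/
theorem isQuasiGreedy_iff_value (hq : 1 < q) (hx : x ≠ 0) :
    IsQuasiGreedy q x a ↔ (∀ i, a i ≤ maxDigit q) ∧ IsInfinite a ∧ value q a = x ∧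
      ∀ n, a n < maxDigit q → value q (shift (n + 1) a) ≤ 1 := by
  constructor
  · intro h
    obtain ⟨h0, -⟩ | ⟨-, h1, h2, h3⟩ := id h
    · exact absurd h0 hx
    obtain ⟨ha, hv⟩ := (isExpansion_iff hq).1 h1
    have hpos : 0 < x := by rw [← hv]; simpa using h2.value_shift_pos hq ha 0
    obtain ⟨b, hb, hbi, hbv, hb1⟩ := exists_infinite_expansion hq hpos (hv ▸ value_le hq ha)
    have hqg := isQuasiGreedy_of_value hq hb hbi hb1
    rw [hbv] at hqg
    rw [h.unique hqg]
    exact ⟨hb, hbi, hbv, hb1⟩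
  · rintro ⟨ha, hi, rfl, h⟩
    exact isQuasiGreedy_of_value hq ha hi h

end QuasiGreedy

/-! ### The quasi-greedy expansion of one -/

open Classical in
/-- The quasi-greedy expansion of `1` in base `q`, for `q > 1`. -/
noncomputable def alpha (q : ℝ) : ℕ → ℕ :=
  if h : ∃ a, IsQuasiGreedy q 1 a then h.choose else 0

section Alpha

variable {q : ℝ}

theorem isQuasiGreedy_alpha (hq : 1 < q) : IsQuasiGreedy q 1 (alpha q) := by
  have h : ∃ a, IsQuasiGreedy q 1 a := by
    obtain ⟨a, ha⟩ := exists_infinite_expansion hq one_pos (one_le_div hq)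
    exact ⟨a, (isQuasiGreedy_iff_value hq one_ne_zero).2 ha⟩
  rw [alpha, dif_pos h]
  exact h.choose_spec

theorem isQuasiGreedy_one_iff (hq : 1 < q) {a : ℕ → ℕ} : IsQuasiGreedy q 1 a ↔ a = alpha q :=
  ⟨fun h => h.unique (isQuasiGreedy_alpha hq), fun h => h ▸ isQuasiGreedy_alpha hq⟩

theorem alpha_le (hq : 1 < q) (i : ℕ) : alpha q i ≤ maxDigit q :=
  ((isQuasiGreedy_iff_value hq one_ne_zero).1 (isQuasiGreedy_alpha hq)).1 i

theorem isInfinite_alpha (hq : 1 < q) : IsInfinite (alpha q) :=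
  ((isQuasiGreedy_iff_value hq one_ne_zero).1 (isQuasiGreedy_alpha hq)).2.1

theorem value_alpha (hq : 1 < q) : value q (alpha q) = 1 :=
  ((isQuasiGreedy_iff_value hq one_ne_zero).1 (isQuasiGreedy_alpha hq)).2.2.1

theorem value_shift_alpha_le (hq : 1 < q) (k : ℕ) : value q (shift k (alpha q)) ≤ 1 := by
  induction k with
  | zero => simp [value_alpha hq]
  | succ k ih =>
    by_cases h : alpha q k < maxDigit q
    · exact ((isQuasiGreedy_iff_value hq one_ne_zero).1 (isQuasiGreedy_alpha hq)).2.2.2 k h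
    · have h1 := value_shift_succ hq (alpha_le hq) k
      have h2 : alpha q k = maxDigit q := le_antisymm (alpha_le hq k) (not_lt.1 h)
      have h3 := le_maxDigit_add_one hq
      have h4 : q * value q (shift k (alpha q)) ≤ q * 1 := by gcongr
      rw [h2] at h1
      linarith

variable {m : ℕ} {y : ℕ → ℕ}

theorem lt_alpha_of_value_lt (hq : 1 < q) (hy : ∀ i, y i ≤ m) (h : value q y < 1) :
    toLex y < toLex (alpha q) := by
  by_contra hle
  rcases (not_lt.1 hle).eq_or_lt with heq | hlt
  · rw [← toLex.injective heq, value_alpha hq] at h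
    exact lt_irrefl _ h
  · obtain ⟨i, hi, hlt⟩ := toLex_lt_iff.1 hlt
    have h1 := value_sub_of_agree hq (m := max m (maxDigit q))
      (fun j => (alpha_le hq j).trans (le_max_right _ _))
      (fun j => (hy j).trans (le_max_left _ _)) hi
    have h2 := value_shift_alpha_le hq (i + 1)
    have h3 := value_nonneg hq (shift (i + 1) y)
    have h4 : (alpha q i : ℝ) + 1 ≤ y i := by exact_mod_cast hlt
    rw [value_alpha hq] at h1
    have h5 : 0 < (1 - value q y) * q ^ (i + 1) := mul_pos (by linarith) (by positivity)
    linarith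

theorem le_alpha_of_value_le (hq : 1 < q) (hy : ∀ i, y i ≤ m) (hinf : IsInfinite y)
    (h : value q y ≤ 1) : toLex y ≤ toLex (alpha q) := by
  by_contra! hlt
  obtain ⟨i, hi, hlt⟩ := toLex_lt_iff.1 hlt
  have h1 := value_sub_of_agree hq (m := max m (maxDigit q))
    (fun j => (alpha_le hq j).trans (le_max_right _ _))
    (fun j => (hy j).trans (le_max_left _ _)) hi
  have h2 := value_shift_alpha_le hq (i + 1)
  have h3 := hinf.value_shift_pos hq hy (i + 1)
  have h4 : (alpha q i : ℝ) + 1 ≤ y i := by exact_mod_cast hlt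
  rw [value_alpha hq] at h1
  have h5 : 0 ≤ (1 - value q y) * q ^ (i + 1) := mul_nonneg (by linarith) (by positivity)
  linarith

/-- If `b` represents `1` and the tails of `a` after its non-maximal digits are at most `b`
lexicographically, then the same comparison holds between their values. The supremum `M` of the
values in question satisfies `M - 1 ≤ (M - 1) / q`, whence `M ≤ 1`. -/
theorem value_shift_le_of_lex {a b : ℕ → ℕ} (hq : 1 < q) (ha : ∀ i, a i ≤ m) (hb : ∀ i, b i ≤ m)
    (hbi : IsInfinite b) (hb1 : value q b = 1)
    (h : ∀ n, a n < m → toLex (shift (n + 1) a) ≤ toLex b) {n : ℕ} (hn : a n < m) :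
    value q (shift (n + 1) a) ≤ 1 ∧
      (toLex (shift (n + 1) a) < toLex b → value q (shift (n + 1) a) < 1) := by
  set S : Set ℝ := {v | ∃ n, a n < m ∧ v = value q (shift (n + 1) a)} with hS
  have hbdd : BddAbove S := by
    refine ⟨m / (q - 1), ?_⟩
    rintro _ ⟨n, -, rfl⟩
    exact value_le hq fun i => ha _
  have hle : ∀ n, a n < m → value q (shift (n + 1) a) ≤ sSup S := fun n hn =>
    le_csSup hbdd ⟨n, hn, rfl⟩
  have key : ∀ n, a n < m → toLex (shift (n + 1) a) < toLex b → ∃ i,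
      (value q (shift (n + 1) a) - 1) * q ^ (i + 1) < sSup S - 1 := by
    intro n hn hlt
    obtain ⟨i, hi, hlt⟩ := toLex_lt_iff.1 hlt
    have h1 := value_sub_of_agree hq (fun j => ha (n + 1 + j)) hb hi
    have h2 := hle (n + 1 + i) (hlt.trans_le (hb i))
    have h3 := hbi.value_shift_pos hq hb (i + 1)
    have h4 : ((shift (n + 1) a i : ℕ) : ℝ) + 1 ≤ b i := by exact_mod_cast hlt
    have h5 : value q (shift (i + 1) fun j => a (n + 1 + j)) =
        value q (shift (n + 1 + i + 1) a) := by
      congr 1; funext j; simp only [shift]; congr 1; ring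
    refine ⟨i, ?_⟩
    rw [hb1, h5] at h1
    have h6 : (shift (n + 1) a) = fun j => a (n + 1 + j) := rfl
    rw [h6] at h4 ⊢
    linarith
  have hM : sSup S ≤ 1 := by
    by_contra! hM
    have : sSup S ≤ 1 + (sSup S - 1) / q := by
      refine csSup_le ⟨_, n, hn, rfl⟩ ?_
      rintro _ ⟨k, hk, rfl⟩
      have hpos : 0 ≤ (sSup S - 1) / q := div_nonneg (by linarith) (by linarith)
      rcases (h k hk).eq_or_lt with heq | hlt
      · rw [toLex.injective heq, hb1]; linarith
      · obtain ⟨i, hi⟩ := key k hk hlt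
        by_contra! hcon
        have h1 : (sSup S - 1) / q < value q (shift (k + 1) a) - 1 := by linarith
        have h2 : q ≤ q ^ (i + 1) := le_self_pow₀ hq.le (by omega)
        have h3 : (sSup S - 1) / q * q < (value q (shift (k + 1) a) - 1) * q ^ (i + 1) := by
          have h0 : 0 < value q (shift (k + 1) a) - 1 := by linarith
          calc (sSup S - 1) / q * q < (value q (shift (k + 1) a) - 1) * q := by gcongr
            _ ≤ _ := by gcongr
        rw [div_mul_cancel₀ _ (by positivity)] at h3
        linarith
    have h1 : (sSup S - 1) / q < sSup S - 1 := div_lt_self (by linarith) hq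
    linarith
  refine ⟨(hle n hn).trans hM, fun hlt => ?_⟩
  obtain ⟨i, hi⟩ := key n hn hlt
  by_contra! hcon
  have : 0 ≤ (value q (shift (n + 1) a) - 1) * q ^ (i + 1) :=
    mul_nonneg (by linarith) (by positivity)
  linarith

/-- The lexicographic characterization of the infinite quasi-greedy expansions. -/
theorem isQuasiGreedy_value_iff (hq : 1 < q) {a : ℕ → ℕ} (ha : ∀ i, a i ≤ maxDigit q)
    (hinf : IsInfinite a) : IsQuasiGreedy q (value q a) a ↔
      ∀ n, a n < maxDigit q → toLex (shift (n + 1) a) ≤ toLex (alpha q) := by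
  have hpos : 0 < value q a := by simpa using hinf.value_shift_pos hq ha 0
  rw [isQuasiGreedy_iff_value hq hpos.ne']
  constructor
  · rintro ⟨-, -, -, h⟩ n hn
    exact le_alpha_of_value_le hq (fun i => ha _) (hinf.shift _) (h n hn)
  · intro h
    exact ⟨ha, hinf, rfl, fun n hn => (value_shift_le_of_lex hq ha (alpha_le hq)
      (isInfinite_alpha hq) (value_alpha hq) h hn).1⟩

/-- An infinite sequence that is not smaller than any of its tails. These are the quasi-greedy
expansions of `1` in the bases `q > 1`. -/
structure IsParry (a : ℕ → ℕ) : Prop where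
  infinite : IsInfinite a
  shift_le : ∀ k, toLex (shift k a) ≤ toLex a

theorem isParry_alpha (hq : 1 < q) : IsParry (alpha q) :=
  ⟨isInfinite_alpha hq, fun k => le_alpha_of_value_le hq (shift_apply_le (alpha_le hq) _)
    ((isInfinite_alpha hq).shift k) (value_shift_alpha_le hq k)⟩

theorem apply_zero_le_of_lex_le {a b : ℕ → ℕ} (h : toLex a ≤ toLex b) : a 0 ≤ b 0 := by
  by_contra! hlt
  exact not_lt.2 h (toLex_lt_iff.2 ⟨0, by simp, hlt⟩)

theorem IsParry.le_zero {a : ℕ → ℕ} (h : IsParry a) (i : ℕ) : a i ≤ a 0 :=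
  apply_zero_le_of_lex_le (h.shift_le i)

theorem IsParry.zero_pos {a : ℕ → ℕ} (h : IsParry a) : 0 < a 0 := by
  obtain ⟨i, -, hi⟩ := h.infinite.exists_ne 0
  have := h.le_zero i
  omega

/-- In a base where it represents `1`, a sequence with `IsParry` is the quasi-greedy expansion
of `1`. -/
theorem IsParry.eq_alpha {a : ℕ → ℕ} (h : IsParry a) (hq : 1 < q) (hv : value q a = 1) :
    a = alpha q := by
  have h0 : a 0 ≤ maxDigit q := by
    rw [← cast_lt_iff hq]
    have h1 := value_shift_succ hq h.le_zero 0
    have h2 := h.infinite.value_shift_pos hq h.le_zero 1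
    rw [shift_zero, hv] at h1
    simp only [zero_add] at h1
    linarith
  have ha : ∀ i, a i ≤ maxDigit q := fun i => (h.le_zero i).trans h0
  rw [← isQuasiGreedy_one_iff hq, isQuasiGreedy_iff_value hq one_ne_zero]
  exact ⟨ha, h.infinite, hv, fun n hn =>
    (value_shift_le_of_lex hq ha ha h.infinite hv (fun k _ => h.shift_le _) hn).1⟩

theorem alpha_zero (hq : 1 < q) : alpha q 0 = maxDigit q := by
  refine le_antisymm (alpha_le hq 0) ?_
  by_contra! hlt
  have h1 := value_shift_succ hq (alpha_le hq) 0
  have h2 : value q (shift 1 (alpha q)) ≤ alpha q 0 / (q - 1) :=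
    value_le hq fun i => (isParry_alpha hq).le_zero _
  have h3 := value_shift_alpha_le hq 1
  have h4 := maxDigit_lt hq
  have h5 : (alpha q 0 : ℝ) + 1 ≤ maxDigit q := by exact_mod_cast hlt
  rw [shift_zero, value_alpha hq] at h1
  simp only [zero_add] at h1
  linarith

theorem alpha_lt_alpha {r : ℝ} (hq : 1 < q) (hqr : q < r) :
    toLex (alpha q) < toLex (alpha r) := by
  refine lt_alpha_of_value_lt (hq.trans hqr) (alpha_le hq) ?_
  obtain ⟨i, -, hi⟩ := (isInfinite_alpha hq).exists_ne 0
  rw [← value_alpha hq]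
  exact value_lt_value hq hqr (alpha_le hq) hi

theorem alpha_lt_alpha_iff {r : ℝ} (hq : 1 < q) (hr : 1 < r) :
    toLex (alpha q) < toLex (alpha r) ↔ q < r := by
  refine ⟨fun h => ?_, alpha_lt_alpha hq⟩
  by_contra! hle
  rcases hle.eq_or_lt with rfl | hlt
  · exact lt_irrefl _ h
  · exact lt_asymm h (alpha_lt_alpha hr hlt)

theorem alpha_le_alpha_iff {r : ℝ} (hq : 1 < q) (hr : 1 < r) :
    toLex (alpha q) ≤ toLex (alpha r) ↔ q ≤ r :=
  not_lt.symm.trans ((not_congr (alpha_lt_alpha_iff hr hq)).trans not_lt)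

theorem continuousOn_value {y : ℕ → ℕ} (hq : 1 < q) (hy : ∀ i, y i ≤ m) :
    ContinuousOn (fun r => value r y) (Ici q) := by
  refine continuousOn_tsum (u := fun i => (m : ℝ) / q ^ (i + 1)) (fun i => ?_)
    (hasSum_const hq m).summable ?_
  · refine ContinuousOn.div continuousOn_const (by fun_prop) fun r hr => ?_
    have : q ≤ r := hr
    have : 0 < r := by linarith
    positivity
  · intro i r hr
    have h1 : q ≤ r := hr
    have h0 : 0 < r := by linarith
    have : (y i : ℝ) ≤ m := by exact_mod_cast hy i
    rw [Real.norm_of_nonneg (by positivity)]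
    gcongr

/-- Every sequence `a` with `IsParry a` is the quasi-greedy expansion of `1` in some base, by the
intermediate value theorem. -/
theorem IsParry.exists_alpha_eq {a : ℕ → ℕ} (h : IsParry a) : ∃ q, 1 < q ∧ alpha q = a := by
  have h0 := h.zero_pos
  have h0' : (1 : ℝ) ≤ a 0 := by exact_mod_cast h0
  obtain ⟨j, hj, hj0⟩ := h.infinite.exists_ne 1
  obtain ⟨r, ⟨hr1, hr⟩, hr2⟩ : ∃ r : ℝ, (1 < r ∧ r < 2) ∧ 1 < 1 / r + 1 / r ^ (j + 1) := by
    have hc : ContinuousAt (fun r : ℝ => 1 / r + 1 / r ^ (j + 1)) 1 := by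
      refine ContinuousAt.add ?_ ?_ <;> refine ContinuousAt.div (by fun_prop) (by fun_prop) ?_ <;>
        simp
    have h1 : ∀ᶠ r : ℝ in 𝓝[>] 1, 1 < 1 / r + 1 / r ^ (j + 1) :=
      nhdsWithin_le_nhds (hc.eventually (lt_mem_nhds (by norm_num)))
    obtain ⟨r, h2, h3⟩ := (h1.and (Ioo_mem_nhdsGT (show (1 : ℝ) < 2 by norm_num))).exists
    exact ⟨r, h3, h2⟩
  have hr0 : 0 < r := by linarith
  have hge : 1 ≤ value r a := by
    have hs := (summable_value hr1 h.le_zero).sum_le_tsum {0, j} fun _ _ => by positivity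
    rw [Finset.sum_pair (by omega)] at hs
    have e1 : 1 / r ≤ (a 0 : ℝ) / r ^ (0 + 1) := by
      rw [zero_add, pow_one]; gcongr
    have e2 : 1 / r ^ (j + 1) ≤ (a j : ℝ) / r ^ (j + 1) := by
      have : (1 : ℝ) ≤ a j := by exact_mod_cast Nat.one_le_iff_ne_zero.2 hj0
      gcongr
    have hs' : (a 0 : ℝ) / r ^ (0 + 1) + (a j : ℝ) / r ^ (j + 1) ≤ value r a := hs
    linarith
  have hle : value ((a 0 : ℝ) + 1) a ≤ 1 := by
    refine (value_le (by linarith) h.le_zero).trans ?_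
    rw [add_sub_cancel_right, div_self (by positivity)]
  obtain ⟨q, ⟨hq1, -⟩, hq⟩ := intermediate_value_Icc' (show r ≤ (a 0 : ℝ) + 1 by linarith)
    ((continuousOn_value hr1 h.le_zero).mono Icc_subset_Ici_self) ⟨hle, hge⟩
  exact ⟨q, by linarith, (h.eq_alpha (by linarith) hq).symm⟩

end Alpha

/-! ### Lexicographic descriptions of univoque sequences and bases -/

/-- The tails of `c` after its digits below `m`, together with the conjugates of the tails of `c`
after its nonzero digits. -/
def tails (m : ℕ) (c : ℕ → ℕ) : Set (ℕ → ℕ) :=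
  {d | ∃ n, (c n < m ∧ d = shift (n + 1) c) ∨ (0 < c n ∧ d = conj m (shift (n + 1) c))}

section Tails

variable {q : ℝ} {m : ℕ} {c d : ℕ → ℕ}

theorem tails_conj (hc : ∀ i, c i ≤ m) : tails m (conj m c) = tails m c := by
  ext d
  refine exists_congr fun n => or_comm.trans (or_congr (and_congr ?_ ?_) (and_congr ?_ ?_))
  · have := hc n
    simp only [conj]; omega
  · rw [shift_conj, conj_conj (shift_apply_le hc _)]
  · have := hc n
    simp only [conj]; omega
  · rw [shift_conj]

theorem tails_le (hc : ∀ i, c i ≤ m) (hd : d ∈ tails m c) (i : ℕ) : d i ≤ m := by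
  obtain ⟨n, ⟨-, rfl⟩ | ⟨-, rfl⟩⟩ := hd
  · exact hc _
  · exact conj_le _ _ _

/-- The conjugate of the zero tail after a last nonzero digit is the largest possible sequence. -/
theorem eq_zero_or_isInfinite_of_tails (hq : 1 < q)
    (h : ∀ d ∈ tails (maxDigit q) c, toLex d < toLex (alpha q)) : c = 0 ∨ IsInfinite c := by
  by_contra! hcon
  obtain ⟨h0, hi⟩ := hcon
  obtain ⟨n, hn, hz⟩ : ∃ n, c n ≠ 0 ∧ ∀ i > n, c i = 0 := by
    have hfin : {i | c i ≠ 0}.Finite := Set.not_infinite.1 hi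
    have hne : {i | c i ≠ 0}.Nonempty := by
      by_contra! he
      refine h0 (funext fun i => ?_)
      by_contra hci
      have : i ∈ {i | c i ≠ 0} := hci
      rw [he] at this
      exact this
    obtain ⟨n, hn, hmax⟩ := hfin.exists_maximalFor id _ hne
    refine ⟨n, hn, fun i hi => ?_⟩
    by_contra hci
    exact absurd (hmax hci hi.le) (not_le.2 hi)
  have hlt := h _ ⟨n, Or.inr ⟨Nat.pos_of_ne_zero hn, rfl⟩⟩
  obtain ⟨i, -, hlt⟩ := toLex_lt_iff.1 hlt
  have h1 := alpha_le hq i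
  simp only [conj, shift] at hlt
  rw [hz _ (by omega)] at hlt
  omega

/-- The lexicographic characterization of unique expansions. -/
theorem existsUnique_iff (hq : 1 < q) (hc : ∀ i, c i ≤ maxDigit q) :
    (∀ b, IsExpansion q (value q c) b → b = c) ↔
      ∀ d ∈ tails (maxDigit q) c, toLex d < toLex (alpha q) := by
  have hq0 : 0 < q := by linarith
  constructor
  · intro huniq
    -- A tail that violates the inequality can be exchanged together with the digit before it.
    have exchange : ∀ (n e : ℕ) (v : ℝ), e ≤ maxDigit q → e ≠ c n → 0 ≤ v →
        v ≤ maxDigit q / (q - 1) → (e : ℝ) + v = c n + value q (shift (n + 1) c) → False := by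
      intro n e v he hne hv hv' hev
      obtain ⟨t, ht, htv⟩ := exists_expansion hq hv hv'
      let b : ℕ → ℕ := fun i => if i < n then c i else if i = n then e else t (i - (n + 1))
      have hb : ∀ i, b i ≤ maxDigit q := by
        intro i
        simp only [b]
        split_ifs
        exacts [hc i, he, ht _]
      have hbn : b n = e := by simp [b]
      have hbs : shift (n + 1) b = t := by
        funext i
        simp only [shift, b]
        rw [if_neg (by omega), if_neg (by omega)]
        congr 1; omega
      have h1 := value_sub_of_agree hq hb hc (i := n) fun j hj => by simp [b, hj]
      rw [hbs, htv, hbn, hev, sub_self] at h1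
      have h2 : value q b = value q c := by
        rcases mul_eq_zero.1 h1 with h | h
        · linarith
        · exact absurd h (by positivity)
      have h3 := huniq b ((isExpansion_iff hq).2 ⟨hb, h2⟩)
      rw [h3] at hbn
      exact hne hbn.symm
    rintro d ⟨n, ⟨hn, rfl⟩ | ⟨hn, rfl⟩⟩
    · refine lt_alpha_of_value_lt hq (fun i => hc _) ?_
      by_contra! hge
      refine exchange n (c n + 1) (value q (shift (n + 1) c) - 1) hn (by omega) (by linarith) ?_
        (by push_cast; ring)
      linarith [value_le hq (c := shift (n + 1) c) (fun i => hc _)]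
    · refine lt_alpha_of_value_lt hq (conj_le _ _) ?_
      by_contra! hge
      rw [value_conj hq (shift_apply_le hc _)] at hge
      refine exchange n (c n - 1) (value q (shift (n + 1) c) + 1) ((Nat.sub_le _ _).trans (hc n))
        (by omega) (by linarith [value_nonneg hq (shift (n + 1) c)]) (by linarith) ?_
      rw [Nat.cast_sub hn]; push_cast; ring
  · intro h b hb
    obtain ⟨hb, hbv⟩ := (isExpansion_iff hq).1 hb
    by_contra hne
    have hval : ∀ c : ℕ → ℕ, (∀ i, c i ≤ maxDigit q) →
        (∀ d ∈ tails (maxDigit q) c, toLex d < toLex (alpha q)) → ∀ n, c n < maxDigit q →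
        value q (shift (n + 1) c) < 1 := fun c hc h n hn =>
      (value_shift_le_of_lex hq hc (alpha_le hq) (isInfinite_alpha hq) (value_alpha hq)
        (fun k hk => (h _ ⟨k, Or.inl ⟨hk, rfl⟩⟩).le) hn).2 (h _ ⟨n, Or.inl ⟨hn, rfl⟩⟩)
    rcases lt_or_gt_of_ne (toLex.injective.ne hne) with hlt | hlt
    · obtain ⟨i, hi, hlt⟩ := toLex_lt_iff.1 hlt
      have h1 := value_sub_of_agree hq hb hc hi
      have h2 := hval (conj (maxDigit q) c) (conj_le _ _) (by rwa [tails_conj hc]) i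
        (by have := hc i
            simp only [conj]; omega)
      rw [shift_conj, value_conj hq (shift_apply_le hc _)] at h2
      have h3 := value_le hq (c := shift (i + 1) b) (fun i => hb _)
      have h4 : (b i : ℝ) + 1 ≤ c i := by exact_mod_cast hlt
      rw [hbv, sub_self, zero_mul] at h1
      linarith
    · obtain ⟨i, hi, hlt⟩ := toLex_lt_iff.1 hlt
      have h1 := value_sub_of_agree hq hb hc (i := i) fun j hj => (hi j hj).symm
      have h2 := hval c hc h i (hlt.trans_le (hb i))
      have h3 := value_nonneg hq (shift (i + 1) b)
      have h4 : (c i : ℝ) + 1 ≤ b i := by exact_mod_cast hlt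
      rw [hbv, sub_self, zero_mul] at h1
      linarith

theorem mem_Uq'_iff (hq : 1 < q) : c ∈ Uq' q ↔ (∀ i, c i ≤ maxDigit q) ∧
    ∀ d ∈ tails (maxDigit q) c, toLex d < toLex (alpha q) := by
  constructor
  · rintro ⟨x, ⟨e, he, heu⟩, hqg⟩
    have hce : IsExpansion q x c := by
      rcases hqg with ⟨rfl, rfl⟩ | ⟨-, h, -⟩
      · exact (isExpansion_iff hq).2 ⟨fun i => by simp, by simp [value]⟩
      · exact h
    obtain rfl := heu c hce
    obtain ⟨hc, rfl⟩ := (isExpansion_iff hq).1 hce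
    exact ⟨hc, (existsUnique_iff hq hc).1 heu⟩
  · rintro ⟨hc, h⟩
    have huniq := (existsUnique_iff hq hc).2 h
    have hexp := (isExpansion_iff hq).2 ⟨hc, rfl⟩
    refine ⟨value q c, ⟨c, hexp, huniq⟩, ?_⟩
    rcases eq_zero_or_isInfinite_of_tails hq h with rfl | hinf
    · exact Or.inl ⟨by simp [value], rfl⟩
    · have hpos : 0 < value q c := by simpa using hinf.value_shift_pos hq hc 0
      exact Or.inr ⟨hpos.ne', hexp, hinf, fun b hb _ => (huniq b hb) ▸ le_rfl⟩

theorem mem_Vq'_iff (hq : 1 < q) : c ∈ Vq' q ↔ (∀ i, c i ≤ maxDigit q) ∧ (c = 0 ∨ IsInfinite c) ∧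
    ∀ d ∈ tails (maxDigit q) c, toLex d ≤ toLex (alpha q) := by
  have hceil : ((⌈q⌉ : ℤ) : ℝ) - 1 = maxDigit q := by
    have h1 : (⌈q⌉₊ : ℝ) = ((⌈q⌉ : ℤ) : ℝ) := by
      exact_mod_cast natCast_ceil_eq_intCast_ceil (by linarith : 0 ≤ q)
    have h2 : 1 ≤ ⌈q⌉₊ := Nat.one_le_ceil_iff.2 (by linarith)
    rw [maxDigit, Nat.cast_sub h2, h1, Nat.cast_one]
  constructor
  · rintro ⟨x, ⟨-, α, a, hα, ha, h⟩, hqg⟩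
    obtain rfl := ha.unique hqg
    obtain rfl := (isQuasiGreedy_one_iff hq).1 hα
    rw [alpha_zero hq] at h
    rcases id hqg with ⟨rfl, rfl⟩ | ⟨hx, hexp, hinf, -⟩
    · refine ⟨fun i => by simp, Or.inl rfl, ?_⟩
      rintro d ⟨n, ⟨-, rfl⟩ | ⟨hn, -⟩⟩
      · exact Pi.toLex_monotone fun i => by simp [shift]
      · simp at hn
    · obtain ⟨hc, rfl⟩ := (isExpansion_iff hq).1 hexp
      refine ⟨hc, Or.inr hinf, ?_⟩
      rintro d ⟨n, ⟨hn, rfl⟩ | ⟨hn, rfl⟩⟩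
      · exact (isQuasiGreedy_value_iff hq hc hinf).1 hqg n hn
      · exact h n hn
  · rintro ⟨hc, hz, h⟩
    have hqg : IsQuasiGreedy q (value q c) c := by
      rcases hz with rfl | hinf
      · exact Or.inl ⟨by simp [value], rfl⟩
      · exact (isQuasiGreedy_value_iff hq hc hinf).2 fun n hn => h _ ⟨n, Or.inl ⟨hn, rfl⟩⟩
    refine ⟨value q c, ⟨⟨value_nonneg hq c, ?_⟩, alpha q, c, isQuasiGreedy_alpha hq, hqg,
      fun n hn => ?_⟩, hqg⟩
    · rw [hceil]; exact value_le hq hc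
    · rw [alpha_zero hq]
      exact h _ ⟨n, Or.inr ⟨hn, rfl⟩⟩

theorem mem_U_iff : q ∈ U ↔ 1 < q ∧
    ∀ d ∈ tails (maxDigit q) (alpha q), toLex d < toLex (alpha q) := by
  refine and_congr_right fun hq => ?_
  rw [← existsUnique_iff hq (alpha_le hq), value_alpha hq]
  have hα := (isExpansion_iff hq).2 ⟨alpha_le hq, value_alpha hq⟩
  constructor
  · rintro ⟨e, -, he⟩ b hb
    rw [he b hb, he _ hα]
  · exact fun h => ⟨alpha q, hα, h⟩

theorem mem_V_iff : q ∈ V ↔ 1 < q ∧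
    ∀ k, 1 ≤ k → toLex (conj (maxDigit q) (shift k (alpha q))) ≤ toLex (alpha q) := by
  refine and_congr_right fun hq => ⟨?_, fun h => ⟨alpha q, isQuasiGreedy_alpha hq, ?_⟩⟩
  · rintro ⟨a, ha, h⟩
    rw [isQuasiGreedy_one_iff hq] at ha
    subst ha
    rwa [alpha_zero hq] at h
  · rwa [alpha_zero hq]

/-- The bases `q > 1` for which the conjugates of all proper tails of the quasi-greedy expansion
`α` of `1` are strictly smaller than `α`. They turn out to form the closure of `U`. -/
def strictV : Set ℝ :=
  {q | 1 < q ∧ ∀ k, 1 ≤ k → toLex (conj (maxDigit q) (shift k (alpha q))) < toLex (alpha q)}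

theorem strictV_subset_V : strictV ⊆ V :=
  fun _ h => mem_V_iff.2 ⟨h.1, fun k hk => (h.2 k hk).le⟩

theorem U_subset_strictV : U ⊆ strictV := by
  intro q hqU
  obtain ⟨hq, h⟩ := mem_U_iff.1 hqU
  refine ⟨hq, fun k hk => ?_⟩
  obtain ⟨k, rfl⟩ := Nat.exists_eq_add_of_le' hk
  clear hk
  induction k with
  | zero =>
    refine h _ ⟨0, Or.inr ⟨?_, rfl⟩⟩
    exact (isParry_alpha hq).zero_pos
  | succ k ih =>
    rcases Nat.eq_zero_or_pos (alpha q (k + 1)) with h0 | h0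
    · refine lt_of_le_of_lt ?_ ih
      rw [← shift_conj, ← shift_conj]
      refine shift_succ_le (m := maxDigit q) (conj_le _ _) ?_
      simp [conj, h0]
    · exact h _ ⟨k + 1, Or.inr ⟨h0, rfl⟩⟩

theorem mem_U_of_forall_lt (hq : 1 < q)
    (h1 : ∀ k, 1 ≤ k → toLex (shift k (alpha q)) < toLex (alpha q))
    (h2 : ∀ k, 1 ≤ k → toLex (conj (maxDigit q) (shift k (alpha q))) < toLex (alpha q)) :
    q ∈ U := by
  refine mem_U_iff.2 ⟨hq, ?_⟩
  rintro d ⟨n, ⟨-, rfl⟩ | ⟨-, rfl⟩⟩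
  · exact h1 _ (by omega)
  · exact h2 _ (by omega)

/-- A base in `V` outside `strictV` has an expansion of the form `(w w̄)^∞`. -/
theorem exists_conj_shift_eq (hqV : q ∈ V) (hqs : q ∉ strictV) :
    ∃ k, 1 ≤ k ∧ conj (maxDigit q) (shift k (alpha q)) = alpha q := by
  obtain ⟨hq, h⟩ := mem_V_iff.1 hqV
  by_contra! hne
  exact hqs ⟨hq, fun k hk => lt_of_le_of_ne (h k hk) (toLex.injective.ne (hne k hk))⟩

/-- A base in `strictV` outside `U` has a periodic expansion. -/
theorem exists_shift_eq (hqs : q ∈ strictV) (hqU : q ∉ U) :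
    ∃ k, 1 ≤ k ∧ shift k (alpha q) = alpha q := by
  by_contra! hne
  exact hqU (mem_U_of_forall_lt hqs.1 (fun k hk => lt_of_le_of_ne
    ((isParry_alpha hqs.1).shift_le k) (toLex.injective.ne (hne k hk))) hqs.2)

end Tails

/-! ### Approximation of strict bases from the left -/

/-- A sequence ending in zeros has a tail with conjugate `m^∞`. -/
theorem isInfinite_of_conj_le {m : ℕ} {d : ℕ → ℕ} (hm : 0 < m) (hd : ∀ i, d i ≤ m)
    (h : ∀ k, 1 ≤ k → toLex (conj m (shift k d)) ≤ toLex d) : IsInfinite d := by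
  refine isInfinite_iff.2 fun k => ?_
  by_contra! hz
  have h1 : toLex d < toLex (conj m (shift (k + 1) d)) := by
    refine Pi.toLex_strictMono (lt_of_le_of_ne (fun i => ?_) fun he => ?_)
    · have := hd i
      simp only [conj, shift]
      rw [hz (k + 1 + i) (by omega)]
      omega
    · have := congrFun he k
      simp only [conj, shift] at this
      rw [hz k le_rfl, hz (k + 1 + k) (by omega)] at this
      omega
  exact not_le.2 h1 (h (k + 1) (by omega))

theorem exists_mem_V_alpha_eq {m : ℕ} {d : ℕ → ℕ} (hm : 0 < m) (hd0 : d 0 = m)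
    (h1 : ∀ k, toLex (shift k d) ≤ toLex d)
    (h2 : ∀ k, 1 ≤ k → toLex (conj m (shift k d)) ≤ toLex d) :
    ∃ r ∈ V, alpha r = d ∧ maxDigit r = m := by
  have hd : ∀ i, d i ≤ m := fun i => hd0 ▸ apply_zero_le_of_lex_le (h1 i)
  obtain ⟨r, hr, hrd⟩ := IsParry.exists_alpha_eq ⟨isInfinite_of_conj_le hm hd h2, h1⟩
  have hrm : maxDigit r = m := by rw [← alpha_zero hr, hrd, hd0]
  exact ⟨r, mem_V_iff.2 ⟨hr, by rwa [hrm, hrd]⟩, hrd, hrm⟩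

/-- The first `n` digits of `a` are lexicographically smaller than those of `b`. -/
def PrefixLT (n : ℕ) (a b : ℕ → ℕ) : Prop := ∃ i < n, (∀ j < i, a j = b j) ∧ a i < b i

section Prefix

variable {n l m : ℕ} {a b c d : ℕ → ℕ}

theorem PrefixLT.mono (h : PrefixLT n a b) (hnl : n ≤ l) : PrefixLT l a b := by
  obtain ⟨i, hi, h⟩ := h
  exact ⟨i, by omega, h⟩

theorem PrefixLT.toLex_lt (h : PrefixLT n a b) (hc : ∀ j < n, c j = a j) (hd : ∀ j < n, d j = b j) :
    toLex c < toLex d := by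
  obtain ⟨i, hi, h1, h2⟩ := h
  refine toLex_lt_iff.2 ⟨i, fun j hj => ?_, ?_⟩
  · rw [hc j (by omega), hd j (by omega), h1 j hj]
  · rwa [hc i hi, hd i hi]

theorem exists_prefixLT (h : toLex a < toLex b) : ∃ n, PrefixLT n a b := by
  obtain ⟨i, h⟩ := toLex_lt_iff.1 h
  exact ⟨i + 1, i, by omega, h⟩

/-- The prefix `w` of length `n` of `a` is such that the conjugate of every proper suffix of `w`
is strictly smaller than the prefix of `w` of the same length. -/
def GoodPrefix (m : ℕ) (a : ℕ → ℕ) (n : ℕ) : Prop :=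
  ∀ i, 1 ≤ i → i < n → PrefixLT (n - i) (conj m (shift i a)) a

/-- A length `n` that is not good has a least witness `i`, and minimality makes `i` itself good;
this `i` is large when `n` is. -/
theorem exists_goodPrefix (h1 : ∀ k, toLex (shift k a) ≤ toLex a)
    (h2 : ∀ k, 1 ≤ k → toLex (conj m (shift k a)) < toLex a) (N : ℕ) :
    ∃ n > N, GoodPrefix m a n := by
  have h3 : ∀ k, ∃ i, 1 ≤ k → (∀ j < i, conj m (shift k a) j = a j) ∧
      conj m (shift k a) i < a i := by
    intro k
    by_cases hk : 1 ≤ k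
    · obtain ⟨i, hi⟩ := toLex_lt_iff.1 (h2 k hk)
      exact ⟨i, fun _ => hi⟩
    · exact ⟨0, fun h => absurd h hk⟩
  choose f hf using h3
  suffices h : ∃ n > N, ∀ i, 1 ≤ i → i < n → i + f i < n by
    obtain ⟨n, hn, h⟩ := h
    exact ⟨n, hn, fun i hi hin => ⟨f i, by have := h i hi hin; omega, hf i hi⟩⟩
  obtain ⟨M, hM⟩ : ∃ M, ∀ i ≤ N, i + f i < M := by
    refine ⟨(Finset.range (N + 1)).sup (fun i => i + f i) + 1, fun i hi => Nat.lt_succ_of_le ?_⟩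
    exact Finset.le_sup (f := fun i => i + f i) (Finset.mem_range.2 (by omega))
  by_cases hgood : ∀ i, 1 ≤ i → i < M + N + 1 → i + f i < M + N + 1
  · exact ⟨M + N + 1, by omega, hgood⟩
  push Not at hgood
  classical
  obtain ⟨hi1, hin, hi⟩ := Nat.find_spec hgood
  have hmin := fun j => Nat.find_min hgood (m := j)
  set i := Nat.find hgood
  refine ⟨i, ?_, fun j hj hji => ?_⟩
  · by_contra! hiN
    have := hM i hiN
    omega
  · by_contra! hcon
    have hjn : j + f j < M + N + 1 := by
      by_contra! h
      exact hmin j hji ⟨hj, by omega, h⟩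
    obtain ⟨hj1, hj2⟩ := hf j hj
    obtain ⟨hi1, -⟩ := hf i hi1
    refine absurd (h1 (i - j)) (not_le.2 (toLex_lt_iff.2 ⟨j + f j - i, fun s hs => ?_, ?_⟩))
    · have e1 := hj1 (i - j + s) (by omega)
      have e2 := hi1 s (by omega)
      simp only [conj, shift] at e1 e2 ⊢
      rw [show j + (i - j + s) = i + s by omega] at e1
      omega
    · have e2 := hi1 (j + f j - i) (by omega)
      simp only [conj, shift] at e2 hj2 ⊢
      rw [show i + (j + f j - i) = j + f j by omega] at e2
      rw [show i - j + (j + f j - i) = f j by omega]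
      omega

/-- The sequence `(w w̄)^∞`, where `w` is the prefix of length `n` of `a`. -/
def antiperiodic (m : ℕ) (a : ℕ → ℕ) (n : ℕ) : ℕ → ℕ :=
  fun i => if (i / n) % 2 = 0 then a (i % n) else m - a (i % n)

theorem antiperiodic_apply {i : ℕ} (hi : i < n) : antiperiodic m a n i = a i := by
  simp [antiperiodic, Nat.div_eq_of_lt hi, Nat.mod_eq_of_lt hi]

theorem antiperiodic_le (ha : ∀ i, a i ≤ m) (i : ℕ) : antiperiodic m a n i ≤ m := by
  unfold antiperiodic
  split_ifs
  · exact ha _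
  · exact Nat.sub_le _ _

theorem shift_antiperiodic (hn : 0 < n) (ha : ∀ i, a i ≤ m) :
    shift n (antiperiodic m a n) = conj m (antiperiodic m a n) := by
  funext i
  have h := ha (i % n)
  simp only [shift, conj, antiperiodic, Nat.add_mod_left, Nat.add_div_left i hn]
  split_ifs <;> omega

theorem antiperiodic_lt (hn : 0 < n) (ha : ∀ i, a i ≤ m)
    (h2 : ∀ k, 1 ≤ k → toLex (conj m (shift k a)) < toLex a) :
    toLex (antiperiodic m a n) < toLex a := by
  have hb := antiperiodic_le (n := n) ha
  have hs := shift_antiperiodic hn ha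
  by_contra hle
  refine absurd (h2 n hn) (not_lt.2 ?_)
  rcases (not_lt.1 hle).eq_or_lt with heq | hlt
  · have h : a = antiperiodic m a n := toLex.injective heq
    rw [← h] at hs
    rw [hs, conj_conj ha]
  · have h := shift_lt_shift (n := n) (fun j hj => (antiperiodic_apply hj).symm) hlt
    rw [hs, ← conj_lt_conj (conj_le _ _) (shift_apply_le ha _), conj_conj hb] at h
    exact (hlt.trans h).le

/-- If `w` is a good prefix, then no tail of `(w w̄)^∞` or of its conjugate exceeds
`(w w̄)^∞`. -/
theorem shift_antiperiodic_le (hm : 0 < m) (ha0 : a 0 = m) (ha : ∀ i, a i ≤ m)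
    (h1 : ∀ k, toLex (shift k a) ≤ toLex a) (hn : 0 < n) (hg : GoodPrefix m a n) (k : ℕ) :
    toLex (shift k (antiperiodic m a n)) ≤ toLex (antiperiodic m a n) ∧
      toLex (conj m (shift k (antiperiodic m a n))) ≤ toLex (antiperiodic m a n) := by
  set β := antiperiodic m a n with hβ
  have hb : ∀ i, β i ≤ m := antiperiodic_le ha
  have hs : shift n β = conj m β := shift_antiperiodic hn ha
  have hconj : ∀ k, 1 ≤ k → k < n → toLex (conj m (shift k β)) < toLex β := fun k hk hkn =>
    (hg k hk hkn).toLex_lt (fun j hj => by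
      simp only [conj, shift, hβ]; rw [antiperiodic_apply (by omega)])
      fun j hj => antiperiodic_apply (by omega)
  induction k using Nat.strong_induction_on with
  | _ k ih =>
    rcases le_or_gt n k with hnk | hkn
    · obtain ⟨i, rfl⟩ := Nat.exists_eq_add_of_le hnk
      rw [← shift_shift, hs, shift_conj, conj_conj (shift_apply_le hb _)]
      exact (ih i (by omega)).symm
    rcases Nat.eq_zero_or_pos k with rfl | hk
    · refine ⟨by rw [shift_zero], (toLex_lt_iff.2 ⟨0, by simp, ?_⟩).le⟩
      have : β 0 = m := by rw [hβ, antiperiodic_apply hn, ha0]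
      simp only [conj, shift, this]
      omega
    · refine ⟨?_, (hconj k hk hkn).le⟩
      -- If the tail were larger, then it would begin with the suffix of length `n - k` of `w`, and
      -- deleting that suffix would contradict the bound on the conjugate tail at `n - k`.
      by_contra hle
      have hlt := not_le.1 hle
      obtain ⟨i, hi, hi'⟩ := toLex_lt_iff.1 hlt
      by_cases hik : k + i < n
      · refine absurd (h1 k) (not_le.2 (toLex_lt_iff.2 ⟨i, fun j hj => ?_, ?_⟩))
        · have := hi j hj
          simp only [shift, hβ] at this
          rwa [antiperiodic_apply (by omega), antiperiodic_apply (by omega)] at this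
        · simp only [shift, hβ] at hi'
          rwa [antiperiodic_apply (by omega), antiperiodic_apply (by omega)] at hi'
      · have h := shift_lt_shift (n := n - k) (fun j hj => hi j (by omega)) hlt
        rw [shift_shift, show k + (n - k) = n by omega, hs,
          ← conj_lt_conj (conj_le _ _) (shift_apply_le hb _), conj_conj hb] at h
        exact lt_asymm h (hconj (n - k) (by omega) (by omega))

end Prefix

section Strict

variable {q : ℝ} {e : ℕ → ℕ}

theorem exists_mem_V_lt (hq : q ∈ strictV) (he : toLex e < toLex (alpha q)) :
    ∃ r ∈ V, r < q ∧ toLex e < toLex (alpha r) := by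
  obtain ⟨hq1, h2⟩ := hq
  have h1 := (isParry_alpha hq1).shift_le
  have hm := one_le_maxDigit hq1
  obtain ⟨N, hN⟩ := exists_prefixLT he
  obtain ⟨n, hn, hg⟩ := exists_goodPrefix h1 h2 N
  have hn0 : 0 < n := by omega
  have hβ := shift_antiperiodic_le hm (alpha_zero hq1) (alpha_le hq1) h1 hn0 hg
  obtain ⟨r, hrV, hr, -⟩ := exists_mem_V_alpha_eq hm
    (by rw [antiperiodic_apply hn0, alpha_zero hq1]) (fun k => (hβ k).1) (fun k _ => (hβ k).2)
  refine ⟨r, hrV, ?_, ?_⟩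
  · rw [← alpha_lt_alpha_iff hrV.1 hq1, hr]
    exact antiperiodic_lt hn0 (alpha_le hq1) h2
  · rw [hr]
    exact hN.toLex_lt (fun _ _ => rfl) fun j hj => antiperiodic_apply (by omega)

/-- If `α` is periodic, then the sequences `v (w̄ w)^∞` with `v` and `w` long good prefixes of `α`,
and `v` much longer than `w`, are quasi-greedy expansions of `1` in univoque bases. -/
theorem exists_mem_U_le (hq : q ∈ strictV) (he : toLex e < toLex (alpha q)) :
    ∃ r ∈ U, r ≤ q ∧ toLex e < toLex (alpha r) := by
  by_cases hqU : q ∈ U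
  · exact ⟨q, hqU, le_rfl, he⟩
  obtain ⟨p, hp, hper⟩ := exists_shift_eq hq hqU
  obtain ⟨hq1, h2⟩ := hq
  have h1 := (isParry_alpha hq1).shift_le
  have hm := one_le_maxDigit hq1
  have ha := alpha_le hq1
  have ha0 := alpha_zero hq1
  set a := alpha q with haq
  set m := maxDigit q with hmq
  obtain ⟨n₀, hn₀⟩ : ∃ n₀, ∀ k, 1 ≤ k → PrefixLT n₀ (conj m (shift k a)) a := by
    have h3 : ∀ k, ∃ n, 1 ≤ k → PrefixLT n (conj m (shift k a)) a := by
      intro k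
      by_cases hk : 1 ≤ k
      · obtain ⟨n, hn⟩ := exists_prefixLT (h2 k hk)
        exact ⟨n, fun _ => hn⟩
      · exact ⟨0, fun h => absurd h hk⟩
    choose f hf using h3
    refine ⟨(Finset.range (p + 1)).sup f, fun k => ?_⟩
    induction k using Nat.strong_induction_on with
    | _ k ih =>
      intro hk
      rcases le_or_gt k p with hkp | hkp
      · exact (hf k hk).mono (Finset.le_sup (Finset.mem_range.2 (by omega)))
      · have := ih (k - p) (by omega) (by omega)
        rwa [← hper, shift_shift, Nat.add_sub_cancel' hkp.le, hper] at this
  obtain ⟨n, hnn₀, hgn⟩ := exists_goodPrefix h1 h2 n₀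
  have hn0 : 0 < n := by omega
  have hβle := shift_antiperiodic_le hm ha0 ha h1 hn0 hgn
  have hβa := antiperiodic_lt hn0 ha h2
  have hβn : ∀ j < n, antiperiodic m a n j = a j := fun j hj => antiperiodic_apply hj
  have hβb : ∀ j, antiperiodic m a n j ≤ m := antiperiodic_le ha
  set β := antiperiodic m a n
  obtain ⟨n₁, hn₁⟩ := exists_prefixLT hβa
  obtain ⟨n₂, hn₂⟩ := exists_prefixLT he
  obtain ⟨N, hN, hgN⟩ := exists_goodPrefix h1 h2 (n + n₁ + n₂)
  let δ : ℕ → ℕ := fun i => if i < N then a i else conj m β (i - N)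
  have hδN : ∀ j < N, δ j = a j := fun j hj => if_pos hj
  have hδs : shift N δ = conj m β := by
    funext j; simp [shift, δ]
  have hδb : ∀ j, δ j ≤ m := by
    intro j
    simp only [δ]
    split_ifs
    exacts [ha j, conj_le _ _ _]
  have hβδ : toLex β < toLex δ := hn₁.toLex_lt (fun _ _ => rfl) fun j hj => hδN j (by omega)
  have hconj : ∀ k, 1 ≤ k → toLex (conj m (shift k δ)) < toLex δ := by
    intro k hk
    rcases le_or_gt N k with hNk | hkN
    · obtain ⟨i, rfl⟩ := Nat.exists_eq_add_of_le hNk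
      rw [← shift_shift, hδs, shift_conj, conj_conj (shift_apply_le hβb _)]
      exact (hβle i).1.trans_lt hβδ
    · exact (hgN k hk hkN).toLex_lt (fun j hj => by
        simp only [conj, shift]; rw [hδN _ (by omega)]) fun j hj => hδN j (by omega)
  have hshift : ∀ k, 1 ≤ k → toLex (shift k δ) < toLex δ := by
    intro k hk
    rcases le_or_gt N k with hNk | hkN
    · obtain ⟨i, rfl⟩ := Nat.exists_eq_add_of_le hNk
      rw [← shift_shift, hδs, shift_conj]
      exact (hβle i).2.trans_lt hβδ
    -- Otherwise the suffix of length `N - k` of the prefix of `δ` is one of its prefixes, and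
    -- the comparison is decided by `(w̄ w)^∞` and the digits of `a` from position `N - k` on.
    have hsuff : toLex (conj m (shift (N - k) δ)) < toLex β := by
      have hpre : PrefixLT (min k n) (conj m (shift (N - k) a)) a := by
        rcases le_total k n with hkn | hkn
        · rw [min_eq_left hkn]
          simpa [show N - (N - k) = k by omega] using hgN (N - k) (by omega) (by omega)
        · rw [min_eq_right hkn]
          exact (hn₀ (N - k) (by omega)).mono hnn₀.le
      exact hpre.toLex_lt (fun j hj => by
        simp only [conj, shift]; rw [hδN _ (by omega)]) fun j hj => hβn j (by omega)
    by_contra hcon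
    have hcon := not_lt.1 hcon
    have hagree : ∀ j < N - k, δ j = shift k δ j := by
      rcases hcon.eq_or_lt with heq | hlt
      · intro j _
        exact congrFun (toLex.injective heq) j
      · obtain ⟨i, hi, hi'⟩ := toLex_lt_iff.1 hlt
        intro j hj
        refine hi j (lt_of_lt_of_le hj ?_)
        by_contra! hiN
        refine absurd (h1 k) (not_le.2 (toLex_lt_iff.2 ⟨i, fun s hs => ?_, ?_⟩))
        · have := hi s hs
          simp only [shift] at this ⊢
          rwa [hδN _ (by omega), hδN _ (by omega)] at this
        · simp only [shift] at hi' ⊢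
          rwa [hδN _ (by omega), hδN _ (by omega)] at hi'
    have hle : toLex (shift (N - k) δ) ≤ toLex (shift (N - k) (shift k δ)) := by
      rcases hcon.eq_or_lt with heq | hlt
      · rw [← toLex.injective heq]
      · exact (shift_lt_shift hagree hlt).le
    rw [shift_shift, show k + (N - k) = N by omega, hδs,
      ← conj_le_conj (conj_le _ _) (shift_apply_le hδb _), conj_conj hβb] at hle
    exact not_lt.2 hle hsuff
  have hδ0 : δ 0 = m := by rw [hδN 0 (by omega), ha0]
  obtain ⟨r, hrV, hr, hrm⟩ := exists_mem_V_alpha_eq hm hδ0 (fun k => by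
    rcases Nat.eq_zero_or_pos k with rfl | hk
    · rw [shift_zero]
    · exact (hshift k hk).le) fun k hk => (hconj k hk).le
  refine ⟨r, mem_U_of_forall_lt hrV.1 (by rwa [hr]) (by rwa [hr, hrm]), ?_, ?_⟩
  · rw [← alpha_le_alpha_iff hrV.1 hq1, hr]
    refine (lt_of_shift_lt hδN ?_).le
    rw [hδs, ← conj_lt_conj (shift_apply_le ha _) (conj_le _ _), conj_conj hβb]
    exact (hn₀ N (by omega)).toLex_lt (fun _ _ => rfl) fun j hj => hβn j (by omega)
  · rw [hr]
    exact hn₂.toLex_lt (fun _ _ => rfl) fun j hj => hδN j (by omega)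

theorem strictV_subset_closure_U : strictV ⊆ closure U := by
  intro q hq
  rw [Metric.mem_closure_iff]
  intro ε hε
  have hq1 : 1 < q := hq.1
  set t := max ((1 + q) / 2) (q - ε / 2)
  have ht1 : 1 < t := lt_max_of_lt_left (by linarith)
  have htq : t < q := max_lt (by linarith) (by linarith)
  have htε : q - ε / 2 ≤ t := le_max_right _ _
  obtain ⟨r, hrU, hrq, hr⟩ := exists_mem_U_le hq (alpha_lt_alpha ht1 htq)
  rw [alpha_lt_alpha_iff ht1 hrU.1] at hr
  refine ⟨r, hrU, ?_⟩
  rw [Real.dist_eq, abs_of_nonneg (by linarith)]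
  linarith

end Strict

/-! ### Closedness of `V` and isolated points -/

section Closed

variable {q : ℝ}

/-- Along a sequence of bases in `V` with limit `q > 1`, the expansions of `1` accumulate at a
sequence that is again characteristic of a base in `V`; this sequence represents `1` in base `q`,
so it is the quasi-greedy expansion of `1` in base `q`. -/
theorem mem_V_of_tendsto (hq : 1 < q) {r : ℕ → ℝ} (hr : ∀ n, r n ∈ V)
    (hrq : Tendsto r atTop (𝓝 q)) :
    q ∈ V ∧ ∃ φ : ℕ → ℕ, ∀ L, ∃ n, ∀ j < L, alpha (r (φ n)) j = alpha q j := by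
  obtain ⟨B, hB⟩ := hrq.bddAbove_range
  have hM : ∀ n i, alpha (r n) i ≤ maxDigit B := fun n i =>
    (alpha_le (hr n).1 i).trans (maxDigit_mono (hB ⟨n, rfl⟩))
  set M := maxDigit B
  have hK : IsCompact (Set.pi univ fun _ : ℕ => Set.Iic M) :=
    isCompact_univ_pi fun _ => (Set.finite_Iic M).isCompact
  obtain ⟨δ, hδM, φ, hφ, hlim⟩ := hK.tendsto_subseq (x := fun n => alpha (r n))
    fun n i _ => hM n i
  have hδ : ∀ i, δ i ≤ M := fun i => hδM i trivial
  have hdig : ∀ i, ∀ᶠ n in atTop, alpha (r (φ n)) i = δ i := by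
    intro i
    have := (tendsto_pi_nhds.1 hlim) i
    rw [nhds_discrete, tendsto_pure] at this
    exact this
  have hagree : ∀ L, ∀ᶠ n in atTop, ∀ j < L, alpha (r (φ n)) j = δ j := by
    intro L
    have := (Set.finite_Iio L).eventually_all.2 fun i _ => hdig i
    exact this
  have hagree' : ∀ L, ∃ n, ∀ j < L, alpha (r (φ n)) j = δ j := fun L => (hagree L).exists
  have hrφ : Tendsto (fun n => r (φ n)) atTop (𝓝 q) := hrq.comp hφ.tendsto_atTop
  have hval : value q δ = 1 := by
    have hp : 1 < (1 + q) / 2 := by linarith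
    have h : Tendsto (fun n => value (r (φ n)) (alpha (r (φ n)))) atTop (𝓝 (value q δ)) := by
      refine tendsto_tsum_of_dominated_convergence (hasSum_const hp M).summable (fun i => ?_) ?_
      · have h1 : Tendsto (fun n => (δ i : ℝ) / r (φ n) ^ (i + 1)) atTop
            (𝓝 ((δ i : ℝ) / q ^ (i + 1))) :=
          tendsto_const_nhds.div (hrφ.pow _) (by positivity)
        refine h1.congr' ?_
        filter_upwards [hdig i] with n hn
        rw [hn]
      · filter_upwards [hrφ.eventually (lt_mem_nhds (show (1 + q) / 2 < q by linarith))] with n hn i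
        have h0 : 0 < r (φ n) := by linarith
        have : (alpha (r (φ n)) i : ℝ) ≤ M := by exact_mod_cast hM _ i
        rw [Real.norm_of_nonneg (by positivity)]
        gcongr
    have h1 : (fun n => value (r (φ n)) (alpha (r (φ n)))) = fun _ => 1 :=
      funext fun n => value_alpha (hr _).1
    rw [h1] at h
    exact tendsto_nhds_unique h tendsto_const_nhds
  have hshift : ∀ k, toLex (shift k δ) ≤ toLex δ := by
    intro k
    by_contra hle
    obtain ⟨L, hL⟩ := exists_prefixLT (not_le.1 hle)
    obtain ⟨n, hn⟩ := hagree' (k + L)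
    exact not_lt.2 ((isParry_alpha (hr (φ n)).1).shift_le k)
      (hL.toLex_lt (fun j hj => hn j (by omega)) fun j hj => hn _ (by omega))
  have hconj : ∀ k, 1 ≤ k → toLex (conj (δ 0) (shift k δ)) ≤ toLex δ := by
    intro k hk
    by_contra hle
    obtain ⟨L, hL⟩ := exists_prefixLT (not_le.1 hle)
    obtain ⟨n, hn⟩ := hagree' (k + L)
    refine not_lt.2 ((mem_V_iff.1 (hr (φ n))).2 k hk)
      (hL.toLex_lt (fun j hj => hn j (by omega)) fun j hj => ?_)
    rw [← alpha_zero (hr (φ n)).1]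
    simp only [conj, shift]
    rw [hn _ (by omega), hn _ (by omega)]
  have h0 : 0 < δ 0 := by
    obtain ⟨n, hn⟩ := hagree' 1
    rw [← hn 0 one_pos]
    exact (isParry_alpha (hr (φ n)).1).zero_pos
  have hδq : δ = alpha q := IsParry.eq_alpha
    ⟨isInfinite_of_conj_le h0 (fun i => apply_zero_le_of_lex_le (hshift i)) hconj, hshift⟩ hq hval
  subst hδq
  rw [alpha_zero hq] at hconj
  exact ⟨mem_V_iff.2 ⟨hq, hconj⟩, φ, hagree'⟩

/-- The set `V` is bounded away from `1`: for `q < 2` the value of the conjugate of the first tail of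
`α` is `1 / (q - 1) - (q - 1)`, and this must not exceed `1`. -/
theorem three_halves_le_of_mem_V (hq : q ∈ V) : 3 / 2 ≤ q := by
  obtain ⟨hq1, h⟩ := mem_V_iff.1 hq
  by_contra! hlt
  have hm : maxDigit q = 1 := by
    refine le_antisymm (Nat.lt_succ_iff.1 ?_) (one_le_maxDigit hq1)
    have h1 := maxDigit_lt hq1
    have h2 : (maxDigit q : ℝ) < 2 := by linarith
    exact_mod_cast h2
  have h0 : conj (maxDigit q) (alpha q) 0 < maxDigit q := by
    simp [conj, alpha_zero hq1, hm]
  have h1 := (value_shift_le_of_lex hq1 (conj_le (maxDigit q) (alpha q)) (alpha_le hq1)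
    (isInfinite_alpha hq1) (value_alpha hq1) (fun n _ => h (n + 1) (by omega)) h0).1
  rw [shift_conj, value_conj hq1 (shift_apply_le (alpha_le hq1) _)] at h1
  have h2 := value_shift_succ hq1 (alpha_le hq1) 0
  rw [shift_zero, value_alpha hq1, alpha_zero hq1, hm] at h2
  rw [hm] at h1
  simp only [zero_add, Nat.cast_one] at h1 h2
  have h3 : (1 : ℝ) / (q - 1) ≤ q := by linarith
  rw [div_le_iff₀ (by linarith)] at h3
  nlinarith

theorem isClosed_V : IsClosed V := by
  refine IsSeqClosed.isClosed fun r q hr hrq => (mem_V_of_tendsto ?_ hr hrq).1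
  have := ge_of_tendsto' hrq fun n => three_halves_le_of_mem_V (hr n)
  linarith

/-- If `α = (w w̄)^∞`, then `q` is isolated in `V`: expansions of `1` in bases of `V` close to `q`
would begin with `w w̄`, but such an expansion is neither smaller than `α`, because of its
conjugate tails, nor larger than `α`, because of its tails. -/
theorem exists_isolating (hqV : q ∈ V) (hqs : q ∉ strictV) :
    ∃ ε > 0, ∀ r ∈ V, |r - q| < ε → r = q := by
  by_contra! hcon
  choose r hrV hrq hne using fun n : ℕ => hcon (1 / ((n : ℝ) + 1)) (by positivity)
  have hlim : Tendsto r atTop (𝓝 q) := by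
    rw [tendsto_iff_dist_tendsto_zero]
    exact squeeze_zero (fun n => dist_nonneg) (fun n => (hrq n).le)
      tendsto_one_div_add_atTop_nhds_zero_nat
  obtain ⟨k, hk, hkα⟩ := exists_conj_shift_eq hqV hqs
  obtain ⟨-, φ, hφ⟩ := mem_V_of_tendsto hqV.1 hrV hlim
  obtain ⟨n, hn⟩ := hφ (2 * k)
  have hq1 : 1 < q := hqV.1
  have hr := mem_V_iff.1 (hrV (φ n))
  have hrne := hne (φ n)
  set s := r (φ n)
  have hm : maxDigit s = maxDigit q := by
    rw [← alpha_zero hq1, ← alpha_zero hr.1, hn 0 (by omega)]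
  rcases lt_or_gt_of_ne hrne with hlt | hlt
  · have h1 := alpha_lt_alpha hr.1 hlt
    have h2 := shift_lt_shift (n := k) (fun j hj => hn j (by omega)) h1
    rw [← conj_lt_conj (m := maxDigit q) (shift_apply_le (alpha_le hq1) _)
      (shift_apply_le (hm ▸ alpha_le hr.1) _), hkα] at h2
    exact not_lt.2 (hr.2 k hk) (hm ▸ h1.trans h2)
  · have hper : shift (2 * k) (alpha q) = alpha q := by
      have h1 : shift k (alpha q) = conj (maxDigit q) (alpha q) := by
        rw [← hkα, conj_conj (shift_apply_le (alpha_le hq1) _), hkα]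
      rw [two_mul, ← shift_shift, h1, shift_conj, hkα]
    obtain ⟨i, hi, hi'⟩ := toLex_lt_iff.1 (alpha_lt_alpha hq1 hlt)
    have hik : 2 * k ≤ i := by
      by_contra! h
      exact hi'.ne (hn i h).symm
    have hper' : ∀ j, alpha q (2 * k + j) = alpha q j := congrFun hper
    refine not_lt.2 ((isParry_alpha hr.1).shift_le (2 * k))
      (toLex_lt_iff.2 ⟨i - 2 * k, fun j hj => ?_, ?_⟩)
    · rw [← hi j (by omega), shift, ← hi _ (by omega), hper']
    · rw [← hi _ (by omega), shift, ← hper', Nat.add_sub_cancel' hik]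
      exact hi'

theorem closure_U_eq : closure U = strictV := by
  refine Subset.antisymm (fun q hq => ?_) strictV_subset_closure_U
  have hqV : q ∈ V := isClosed_V.closure_subset_iff.2
    (U_subset_strictV.trans strictV_subset_V) hq
  by_contra hqs
  obtain ⟨ε, hε, h⟩ := exists_isolating hqV hqs
  obtain ⟨r, hrU, hr⟩ := Metric.mem_closure_iff.1 hq ε hε
  rw [dist_comm, Real.dist_eq] at hr
  have := h r (strictV_subset_V (U_subset_strictV hrU)) hr
  exact hqs (this ▸ U_subset_strictV hrU)

theorem alpha_natCast_add_one {m : ℕ} (hm : 0 < m) : alpha ((m : ℝ) + 1) = fun _ => m := by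
  have hm' : (0 : ℝ) < m := by exact_mod_cast hm
  refine (IsParry.eq_alpha ⟨isInfinite_iff.2 fun k => ⟨k, le_rfl, hm.ne'⟩, fun k => le_rfl⟩
    (by linarith) ?_).symm
  rw [value, (hasSum_const (by linarith) m).tsum_eq, add_sub_cancel_right, div_self hm'.ne']

theorem natCast_add_one_mem_U {m : ℕ} (hm : 0 < m) : (m : ℝ) + 1 ∈ U := by
  have hm' : (0 : ℝ) < m := by exact_mod_cast hm
  have hq : 1 < (m : ℝ) + 1 := by linarith
  have hα := alpha_natCast_add_one hm
  have hmd : maxDigit ((m : ℝ) + 1) = m := by rw [← alpha_zero hq, hα]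
  refine mem_U_iff.2 ⟨hq, ?_⟩
  rw [hmd, hα]
  rintro d ⟨n, ⟨hn, -⟩ | ⟨-, rfl⟩⟩
  · exact absurd hn (lt_irrefl _)
  · exact toLex_lt_iff.2 ⟨0, by simp, by simpa [conj, shift] using hm⟩

theorem natCast_add_one_mem_V {m : ℕ} (hm : 0 < m) : (m : ℝ) + 1 ∈ V :=
  strictV_subset_V (U_subset_strictV (natCast_add_one_mem_U hm))

end Closed

/-! ### Comparison of the sets of univoque sequences -/

section Stability

variable {m : ℕ} {c d g : ℕ → ℕ} {q s : ℝ}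

/-- An upper bound of the tails of `c` after digits below `m` bounds all later tails as well, since
deleting leading digits `m` does not increase a sequence. -/
theorem shift_le_of_tails_le (hc : ∀ i, c i ≤ m) (hg : ∀ d ∈ tails m c, toLex d ≤ toLex g)
    {n : ℕ} (hn : c n < m) (k : ℕ) : toLex (shift (n + 1 + k) c) ≤ toLex g := by
  induction k with
  | zero => exact hg _ ⟨n, Or.inl ⟨hn, rfl⟩⟩
  | succ k ih =>
    rcases (hc (n + 1 + k)).lt_or_eq with hlt | heq
    · exact hg _ ⟨n + 1 + k, Or.inl ⟨hlt, rfl⟩⟩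
    · exact (shift_succ_le hc heq).trans ih

theorem conj_shift_le_of_tails_le (hc : ∀ i, c i ≤ m) (hg : ∀ d ∈ tails m c, toLex d ≤ toLex g)
    {n : ℕ} (hn : 0 < c n) (k : ℕ) : toLex (conj m (shift (n + 1 + k) c)) ≤ toLex g := by
  refine shift_le_of_tails_le (conj_le m c) (by rwa [tails_conj hc]) ?_ k
  have := hc n
  simp only [conj]; omega

/-- An element of `tails m c` beginning with `m > 0` is preceded by a digit below `m` and followed,
from its second position on, by digits that come after a nonzero one (up to conjugating `c`), so both
kinds of bounds apply to its own tails. -/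
theorem tails_shift_le (hm : 0 < m) (hc : ∀ i, c i ≤ m)
    (hg : ∀ d ∈ tails m c, toLex d ≤ toLex g) (hd : d ∈ tails m c) (hd0 : d 0 = m) (k : ℕ) :
    toLex (shift k d) ≤ toLex g ∧ (1 ≤ k → toLex (conj m (shift k d)) ≤ toLex g) := by
  have key : ∀ c : ℕ → ℕ, (∀ i, c i ≤ m) → (∀ d ∈ tails m c, toLex d ≤ toLex g) → ∀ n, c n < m →
      c (n + 1) = m → toLex (shift (n + 1 + k) c) ≤ toLex g ∧
      (1 ≤ k → toLex (conj m (shift (n + 1 + k) c)) ≤ toLex g) := by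
    intro c hc hg n hn hn1
    refine ⟨shift_le_of_tails_le hc hg hn k, fun hk => ?_⟩
    have := conj_shift_le_of_tails_le hc hg (n := n + 1) (by omega) (k - 1)
    rwa [show n + 1 + 1 + (k - 1) = n + 1 + k by omega] at this
  obtain ⟨n, ⟨hn, rfl⟩ | ⟨hn, rfl⟩⟩ := hd
  · rw [shift_shift]
    exact key c hc hg n hn hd0
  · rw [← shift_conj, shift_shift]
    refine key (conj m c) (conj_le m c) (by rwa [tails_conj hc]) n ?_ hd0
    have := hc n
    simp only [conj]; omega

/-- The supremum of the tails of a univoque sequence, if it begins with the largest digit, is the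
quasi-greedy expansion of `1` in some base of `V`. If that base is not smaller than `s`, then it is
`s` itself and lies in `strictV`, and `V` accumulates at `s` from the left. -/
theorem exists_mem_V_of_mem_tails (hs : 1 < s) (hc : ∀ i, c i ≤ maxDigit s)
    (h : ∀ d ∈ tails (maxDigit s) c, toLex d < toLex (alpha s)) (hd : d ∈ tails (maxDigit s) c)
    (hd0 : d 0 = maxDigit s) : ∃ r ∈ V, r < s ∧ toLex d ≤ toLex (alpha r) := by
  have hm := one_le_maxDigit hs
  set m := maxDigit s with hms
  obtain ⟨g, hg, happrox⟩ := exists_lex_sup (D := tails m c) (fun d hd => tails_le hc hd) ⟨d, hd⟩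
  have hg0 : g 0 = m := by
    obtain ⟨e, he, hej⟩ := happrox 1
    refine le_antisymm ?_ (hd0 ▸ apply_zero_le_of_lex_le (hg d hd))
    rw [← hej 0 one_pos]
    exact tails_le hc he 0
  have happrox' : ∀ n, ∃ e ∈ tails m c, e 0 = m ∧ ∀ j < n, e j = g j := by
    intro n
    obtain ⟨e, he, hej⟩ := happrox (n + 1)
    exact ⟨e, he, (hej 0 (by omega)).trans hg0, fun j hj => hej j (by omega)⟩
  have hshift : ∀ k, toLex (shift k g) ≤ toLex g := by
    intro k
    by_contra hle
    obtain ⟨L, hL⟩ := exists_prefixLT (not_le.1 hle)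
    obtain ⟨e, he, he0, hej⟩ := happrox' (k + L)
    exact not_lt.2 (tails_shift_le hm hc hg he he0 k).1
      (hL.toLex_lt (fun _ _ => rfl) fun j hj => hej _ (by omega))
  have hconj : ∀ k, 1 ≤ k → toLex (conj m (shift k g)) ≤ toLex g := by
    intro k hk
    by_contra hle
    obtain ⟨L, hL⟩ := exists_prefixLT (not_le.1 hle)
    obtain ⟨e, he, he0, hej⟩ := happrox' (k + L)
    refine not_lt.2 ((tails_shift_le hm hc hg he he0 k).2 hk)
      (hL.toLex_lt (fun _ _ => rfl) fun j hj => ?_)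
    simp only [conj, shift]
    rw [hej _ (by omega)]
  have hgs : toLex g ≤ toLex (alpha s) := by
    by_contra hle
    obtain ⟨L, hL⟩ := exists_prefixLT (not_le.1 hle)
    obtain ⟨e, he, -, hej⟩ := happrox' L
    exact lt_asymm (h e he) (hL.toLex_lt (fun _ _ => rfl) hej)
  obtain ⟨r, hrV, rfl, -⟩ := exists_mem_V_alpha_eq hm hg0 hshift hconj
  rcases ((alpha_le_alpha_iff hrV.1 hs).1 hgs).lt_or_eq with hrs | rfl
  · exact ⟨r, hrV, hrs, hg d hd⟩
  by_cases hstrict : r ∈ strictV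
  · obtain ⟨t, htV, htr, hdt⟩ := exists_mem_V_lt hstrict (h d hd)
    exact ⟨t, htV, htr, hdt.le⟩
  · exfalso
    obtain ⟨k, hk, hkα⟩ := exists_conj_shift_eq hrV hstrict
    obtain ⟨e, he, he0, hej⟩ := happrox' k
    have h1 := shift_lt_shift hej (h e he)
    rw [← conj_lt_conj (shift_apply_le (alpha_le hs) _) (shift_apply_le (tails_le hc he) _),
      hkα] at h1
    exact not_lt.2 ((tails_shift_le hm hc hg he he0 k).2 hk) h1

theorem maxDigit_eq_of_forall_mem_V (hq : 1 < q) (hqs : q ≤ s) (h : ∀ r ∈ V, q ≤ r → s ≤ r) :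
    maxDigit q = maxDigit s := by
  have hs : 1 < s := hq.trans_le hqs
  refine le_antisymm (maxDigit_mono hqs) ?_
  by_contra! hlt
  have h1 := h _ (natCast_add_one_mem_V (one_le_maxDigit hq)) (le_maxDigit_add_one hq)
  have h2 := maxDigit_lt hs
  have h3 : (maxDigit q : ℝ) + 1 ≤ maxDigit s := by exact_mod_cast hlt
  linarith

theorem Uq'_subset (hq : 1 < q) (hqs : q ≤ s) (hm : maxDigit q = maxDigit s) : Uq' q ⊆ Uq' s := by
  intro c hc
  have hs : 1 < s := hq.trans_le hqs
  rw [mem_Uq'_iff hq, hm] at hc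
  exact (mem_Uq'_iff hs).2
    ⟨hc.1, fun d hd => (hc.2 d hd).trans_le ((alpha_le_alpha_iff hq hs).2 hqs)⟩

theorem const_mem_Uq' (hs : 1 < s) : (fun _ => maxDigit s) ∈ Uq' s := by
  refine (mem_Uq'_iff hs).2 ⟨fun _ => le_rfl, ?_⟩
  rintro d ⟨n, ⟨hn, -⟩ | ⟨-, rfl⟩⟩
  · exact absurd hn (lt_irrefl _)
  · refine toLex_lt_iff.2 ⟨0, by simp, ?_⟩
    rw [alpha_zero hs]
    simpa [conj, shift] using Nat.lt_of_succ_le (one_le_maxDigit hs)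

/-- The sets of univoque sequences in two bases agree if and only if `V` has no element between
them. -/
theorem Uq'_eq_iff (hq : 1 < q) (hqs : q < s) :
    Uq' q = Uq' s ↔ ∀ r ∈ V, q ≤ r → s ≤ r := by
  have hs : 1 < s := hq.trans hqs
  constructor
  · intro heq r hrV hqr
    by_contra! hrs
    have hr : 1 < r := hrV.1
    have hms : maxDigit s = maxDigit q := by
      refine le_antisymm ?_ (maxDigit_mono hqs.le)
      have h1 := const_mem_Uq' hs
      rw [← heq, mem_Uq'_iff hq] at h1
      exact h1.1 0
    have hmr : maxDigit r = maxDigit s :=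
      le_antisymm (maxDigit_mono hrs.le) (hms ▸ maxDigit_mono hqr)
    have hαrs := alpha_lt_alpha hr hrs
    -- The sequence `0 α(r)` is univoque in base `s` but not in base `q`.
    let c : ℕ → ℕ := fun i => if i = 0 then 0 else alpha r (i - 1)
    have hc1 : ∀ n, shift (n + 1) c = shift n (alpha r) := by
      intro n
      funext i
      simp only [shift, c]
      rw [if_neg (by omega)]
      congr 1; omega
    have hcs : c ∈ Uq' s := by
      refine (mem_Uq'_iff hs).2 ⟨fun i => ?_, ?_⟩
      · simp only [c]
        split_ifs
        · exact Nat.zero_le _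
        · exact hmr ▸ alpha_le hr _
      · rintro d ⟨n, ⟨-, rfl⟩ | ⟨hn, rfl⟩⟩
        · rw [hc1]
          exact ((isParry_alpha hr).shift_le n).trans_lt hαrs
        · rw [hc1, ← hmr]
          refine ((mem_V_iff.1 hrV).2 n ?_).trans_lt hαrs
          by_contra! hn0
          obtain rfl : n = 0 := by omega
          simp [c] at hn
    rw [← heq, mem_Uq'_iff hq] at hcs
    have h1 := hcs.2 (shift 1 c) ⟨0, Or.inl ⟨one_le_maxDigit hq, rfl⟩⟩
    rw [hc1 0, shift_zero, alpha_lt_alpha_iff hr hq] at h1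
    exact not_lt.2 hqr h1
  · intro h
    have hm := maxDigit_eq_of_forall_mem_V hq hqs.le h
    refine Subset.antisymm (Uq'_subset hq hqs.le hm) fun c hc => ?_
    obtain ⟨hc, hct⟩ := (mem_Uq'_iff hs).1 hc
    refine (mem_Uq'_iff hq).2 ⟨hm ▸ hc, fun d hd => ?_⟩
    rw [hm] at hd
    by_contra hle
    have hqd := not_lt.1 hle
    have hd0 : d 0 = maxDigit s := by
      refine le_antisymm (tails_le hc hd 0) ?_
      rw [← hm, ← alpha_zero hq]
      exact apply_zero_le_of_lex_le hqd
    obtain ⟨r, hrV, hrs, hdr⟩ := exists_mem_V_of_mem_tails hs hc hct hd hd0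
    exact not_lt.2 (h r hrV ((alpha_le_alpha_iff hq hrV.1).1 (hqd.trans hdr))) hrs

/-! ### Gaps of `V` and stability intervals -/

/-- The gaps of `V` lie between consecutive elements of `V ∪ {1}`. -/
theorem isVGap_iff {q₁ q₂ : ℝ} : IsVGap q₁ q₂ ↔
    q₁ < q₂ ∧ 1 ≤ q₁ ∧ (q₁ = 1 ∨ q₁ ∈ V) ∧ q₂ ∈ V ∧ ∀ r ∈ V, q₁ < r → q₂ ≤ r := by
  constructor
  · rintro ⟨x, hx, hcomp⟩
    have hxI : x ∈ Ioo q₁ q₂ := hcomp ▸ mem_connectedComponentIn hx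
    have hsub : Ioo q₁ q₂ ⊆ Ioi 1 \ V := hcomp ▸ connectedComponentIn_subset _ _
    have hmax : ∀ I : Set ℝ, I.OrdConnected → x ∈ I → I ⊆ Ioi 1 \ V → I ⊆ Ioo q₁ q₂ :=
      fun I hI hxI hIs => hcomp ▸ hI.isPreconnected.subset_connectedComponentIn hxI hIs
    have h1 : 1 ≤ q₁ := by
      by_contra! hlt
      have hx1 : 1 < x := hx.1
      exact lt_irrefl (1 : ℝ) (hsub ⟨hlt, hx1.trans hxI.2⟩).1
    refine ⟨hxI.1.trans hxI.2, h1, ?_, ?_, fun r hr hq₁ => ?_⟩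
    · by_contra! hcon
      have := hmax (Ico q₁ q₂) ordConnected_Ico ⟨hxI.1.le, hxI.2⟩ fun y hy => by
        rcases hy.1.eq_or_lt with rfl | hlt
        · exact ⟨lt_of_le_of_ne h1 hcon.1.symm, hcon.2⟩
        · exact hsub ⟨hlt, hy.2⟩
      exact lt_irrefl _ (this ⟨le_rfl, hxI.1.trans hxI.2⟩).1
    · by_contra hcon
      have := hmax (Ioc q₁ q₂) ordConnected_Ioc ⟨hxI.1, hxI.2.le⟩ fun y hy => by
        rcases hy.2.eq_or_lt with rfl | hlt
        · exact ⟨lt_of_le_of_lt h1 hy.1, hcon⟩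
        · exact hsub ⟨hy.1, hlt⟩
      exact lt_irrefl _ (this ⟨hxI.1.trans hxI.2, le_rfl⟩).2
    · by_contra! hlt
      exact (hsub ⟨hq₁, hlt⟩).2 hr
  · rintro ⟨hlt, h1, hq₁, hq₂, hV⟩
    have hsub : Ioo q₁ q₂ ⊆ Ioi 1 \ V := fun y hy =>
      ⟨lt_of_le_of_lt h1 hy.1, fun hyV => not_lt.2 (hV y hyV hy.1) hy.2⟩
    obtain ⟨x, hx⟩ := exists_between hlt
    have hxC := mem_connectedComponentIn (hsub hx)
    have hC := connectedComponentIn_subset (Ioi 1 \ V) x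
    have hCo : (connectedComponentIn (Ioi 1 \ V) x).OrdConnected :=
      isPreconnected_connectedComponentIn.ordConnected
    refine ⟨x, hsub hx, Subset.antisymm (fun y hy => ⟨?_, ?_⟩)
      (ordConnected_Ioo.isPreconnected.subset_connectedComponentIn hx hsub)⟩
    · by_contra! hle
      have := hC (hCo.out hy hxC ⟨hle, hx.1.le⟩)
      rcases hq₁ with rfl | hq₁
      · exact lt_irrefl (1 : ℝ) this.1
      · exact this.2 hq₁
    · by_contra! hle
      exact (hC (hCo.out hxC hy ⟨hx.2.le, hle⟩)).2 hq₂

/-- Outside `closure U` the set `V` does not accumulate at `q` from the left, so the gap is delimited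
by the largest element of `V ∪ {1}` below `q` and the smallest element of `V` not below `q`. -/
theorem exists_isVGap (hq : 1 < q) (hqU : q ∉ closure U) :
    ∃ q₁ q₂, IsVGap q₁ q₂ ∧ q ∈ Ioc q₁ q₂ := by
  rw [closure_U_eq] at hqU
  obtain ⟨t, htq, ht⟩ : ∃ t < q, ∀ r ∈ V, r < q → r ≤ t := by
    by_cases hqV : q ∈ V
    · obtain ⟨ε, hε, h⟩ := exists_isolating hqV hqU
      refine ⟨q - ε, by linarith, fun r hr hrq => ?_⟩
      by_contra! hlt
      exact hrq.ne (h r hr (abs_lt.2 ⟨by linarith, by linarith⟩))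
    · obtain ⟨ε, hε, h⟩ := Metric.isOpen_iff.1 isClosed_V.isOpen_compl q hqV
      refine ⟨q - ε, by linarith, fun r hr hrq => ?_⟩
      by_contra! hlt
      refine h ?_ hr
      rw [Metric.mem_ball, Real.dist_eq]
      exact abs_lt.2 ⟨by linarith, by linarith⟩
  obtain ⟨q₂, ⟨hq₂V, hq₂⟩, hmin⟩ : ∃ q₂, IsLeast (V ∩ Ici q) q₂ :=
    ⟨_, (isClosed_V.inter isClosed_Ici).isLeast_csInf
      ⟨_, natCast_add_one_mem_V (one_le_maxDigit hq), le_maxDigit_add_one hq⟩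
      ⟨q, fun y hy => hy.2⟩⟩
  obtain ⟨q₁, ⟨hq₁V, hq₁⟩, hmax⟩ : ∃ q₁, IsGreatest (({1} ∪ V) ∩ Iic (max 1 t)) q₁ :=
    ⟨_, ((isClosed_singleton.union isClosed_V).inter isClosed_Iic).isGreatest_csSup
      ⟨1, Or.inl rfl, mem_Iic.2 (le_max_left _ _)⟩ ⟨max 1 t, fun y hy => hy.2⟩⟩
  have hq₁q : q₁ < q := lt_of_le_of_lt hq₁ (max_lt hq htq)
  refine ⟨q₁, q₂, isVGap_iff.2 ⟨hq₁q.trans_le hq₂,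
    hmax ⟨Or.inl rfl, mem_Iic.2 (le_max_left _ _)⟩, hq₁V, hq₂V, fun r hr hr₁ => ?_⟩, hq₁q, hq₂⟩
  refine hmin ⟨hr, ?_⟩
  by_contra hrq
  exact not_lt.2 (hmax ⟨Or.inr hr, (ht r hr (not_le.1 hrq)).trans (le_max_right _ _)⟩) hr₁

theorem eq_of_mem_closure_U (hqU : q ∈ closure U) (hs : 1 < s) (h : Uq' q = Uq' s) : s = q := by
  rw [closure_U_eq] at hqU
  have hq : 1 < q := hqU.1
  rcases lt_trichotomy s q with hlt | rfl | hlt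
  · obtain ⟨r, hrV, hrq, hr⟩ := exists_mem_V_lt hqU (alpha_lt_alpha hs hlt)
    rw [alpha_lt_alpha_iff hs hrV.1] at hr
    exact absurd ((Uq'_eq_iff hs hlt).1 h.symm r hrV hr.le) (not_le.2 hrq)
  · rfl
  · exact absurd ((Uq'_eq_iff hq hlt).1 h q (strictV_subset_V hqU) le_rfl) (not_le.2 hlt)

section Gap

variable {q₁ q₂ : ℝ}

theorem IsVGap.Uq'_eq (h : IsVGap q₁ q₂) (hq : q ∈ Ioc q₁ q₂) (hs : s ∈ Ioc q₁ q₂) :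
    Uq' q = Uq' s := by
  obtain ⟨-, h1, -, -, hV⟩ := isVGap_iff.1 h
  wlog hqs : q < s generalizing q s
  · rcases (not_lt.1 hqs).eq_or_lt with rfl | hlt
    · rfl
    · exact (this hs hq hlt).symm
  exact (Uq'_eq_iff (lt_of_le_of_lt h1 hq.1) hqs).2 fun r hr hqr =>
    hs.2.trans (hV r hr (hq.1.trans_le hqr))

theorem IsVGap.mem_Ioc (h : IsVGap q₁ q₂) (hq : q ∈ Ioc q₁ q₂) (hs : 1 < s)
    (heq : Uq' q = Uq' s) : s ∈ Ioc q₁ q₂ := by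
  obtain ⟨-, h1, hq₁, hq₂, -⟩ := isVGap_iff.1 h
  constructor
  · by_contra! hle
    rcases hq₁ with rfl | hq₁
    · exact not_lt.2 hle hs
    · exact not_lt.2 ((Uq'_eq_iff hs (hle.trans_lt hq.1)).1 heq.symm q₁ hq₁ hle) hq.1
  · by_contra! hlt
    exact not_lt.2 ((Uq'_eq_iff (lt_of_le_of_lt h1 hq.1) (hq.2.trans_lt hlt)).1 heq q₂ hq₂ hq.2) hlt

theorem IsVGap.isStabilityInterval (h : IsVGap q₁ q₂) : IsStabilityInterval (Ioc q₁ q₂) :=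
  ⟨ordConnected_Ioc, fun _ hy => lt_of_le_of_lt (isVGap_iff.1 h).2.1 hy.1,
    fun _ hq _ hs => h.Uq'_eq hq hs⟩

/-- A tail of a univoque sequence in base `q ∈ (q₁, q₂]` that exceeds `α(q₁)` would yield an element
of `V` in `(q₁, q₂)`. -/
theorem IsVGap.Uq'_eq_Vq' (h : IsVGap q₁ q₂) (hq₁ : q₁ ∈ V \ U) (hq : q ∈ Ioc q₁ q₂) :
    Uq' q = Vq' q₁ := by
  obtain ⟨-, -, -, -, hV⟩ := isVGap_iff.1 h
  have h1 : 1 < q₁ := hq₁.1.1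
  have hq1 : 1 < q := h1.trans hq.1
  have hm : maxDigit q₁ = maxDigit q := by
    refine le_antisymm (maxDigit_mono hq.1.le) ?_
    by_contra! hlt
    -- Otherwise the integer `maxDigit q₁ + 1`, which lies in `U`, would lie in `(q₁, q)`.
    have hpos := one_le_maxDigit h1
    have hne : q₁ ≠ (maxDigit q₁ : ℝ) + 1 := fun he =>
      hq₁.2 (he ▸ natCast_add_one_mem_U hpos)
    have h2 := hV _ (natCast_add_one_mem_V hpos) (lt_of_le_of_ne (le_maxDigit_add_one h1) hne)
    have h3 := maxDigit_lt hq1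
    have h4 : (maxDigit q₁ : ℝ) + 1 ≤ maxDigit q := by exact_mod_cast hlt
    linarith [hq.2]
  have hα := alpha_lt_alpha h1 hq.1
  ext c
  rw [mem_Uq'_iff hq1, mem_Vq'_iff h1, hm]
  constructor
  · rintro ⟨hc, hct⟩
    refine ⟨hc, eq_zero_or_isInfinite_of_tails hq1 hct, fun d hd => ?_⟩
    by_contra hle
    have hlt := not_le.1 hle
    have hd0 : d 0 = maxDigit q := by
      refine le_antisymm (tails_le hc hd 0) ?_
      rw [← hm, ← alpha_zero h1]
      exact apply_zero_le_of_lex_le hlt.le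
    obtain ⟨r, hrV, hrq, hdr⟩ := exists_mem_V_of_mem_tails hq1 hc hct hd hd0
    have hr := (alpha_lt_alpha_iff h1 hrV.1).1 (hlt.trans_le hdr)
    exact not_lt.2 (hV r hrV hr) (hrq.trans_le hq.2)
  · rintro ⟨hc, -, hct⟩
    exact ⟨hc, fun d hd => (hct d hd).trans_lt hα⟩

end Gap

theorem isStabilityInterval_singleton (hq : 1 < q) : IsStabilityInterval {q} :=
  ⟨ordConnected_singleton, by simpa using hq, by rintro _ rfl _ rfl; rfl⟩

theorem maximal_isStabilityInterval_iff {I : Set ℝ} : Maximal IsStabilityInterval I ↔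
    (∃ q ∈ closure U, I = {q}) ∨ ∃ q₁ q₂ : ℝ, IsVGap q₁ q₂ ∧ I = Ioc q₁ q₂ := by
  constructor
  · intro hI
    obtain ⟨q, hqI⟩ : I.Nonempty := by
      by_contra! he
      have := hI.2 (isStabilityInterval_singleton one_lt_two) (he ▸ empty_subset _)
      rw [he] at this
      exact this rfl
    have hq : 1 < q := hI.1.2.1 hqI
    by_cases hqU : q ∈ closure U
    · exact Or.inl ⟨q, hqU, Subset.antisymm
        (fun s hs => eq_of_mem_closure_U hqU (hI.1.2.1 hs) (hI.1.2.2 q hqI s hs))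
        (singleton_subset_iff.2 hqI)⟩
    · obtain ⟨q₁, q₂, hgap, hqg⟩ := exists_isVGap hq hqU
      have hsub : I ⊆ Ioc q₁ q₂ := fun s hs =>
        hgap.mem_Ioc hqg (hI.1.2.1 hs) (hI.1.2.2 q hqI s hs)
      exact Or.inr ⟨q₁, q₂, hgap, Subset.antisymm hsub (hI.2 hgap.isStabilityInterval hsub)⟩
  · rintro (⟨q, hqU, rfl⟩ | ⟨q₁, q₂, hgap, rfl⟩)
    · have hq : 1 < q := by
        rw [closure_U_eq] at hqU
        exact hqU.1
      exact ⟨isStabilityInterval_singleton hq, fun K hK hqK s hs => eq_of_mem_closure_U hqU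
        (hK.2.1 hs) (hK.2.2 q (hqK rfl) s hs)⟩
    · have hq₂ : q₂ ∈ Ioc q₁ q₂ := ⟨(isVGap_iff.1 hgap).1, le_rfl⟩
      exact ⟨hgap.isStabilityInterval, fun K hK hgK s hs => hgap.mem_Ioc hq₂ (hK.2.1 hs)
        (hK.2.2 q₂ (hgK hq₂) s hs)⟩

end Stability

end Expansions

theorem theorem1p7 :
    (∀ I : Set ℝ, Maximal Expansions.IsStabilityInterval I ↔
      (∃ q ∈ closure Expansions.U, I = {q}) ∨
      (∃ q₁ q₂ : ℝ, Expansions.IsVGap q₁ q₂ ∧ I = Set.Ioc q₁ q₂)) ∧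
    (∀ q₁ q₂ : ℝ, Expansions.IsVGap q₁ q₂ → q₁ ∈ Expansions.V \ Expansions.U →
      ∀ q ∈ Set.Ioc q₁ q₂, Expansions.Uq' q = Expansions.Vq' q₁) :=
  ⟨fun _ => Expansions.maximal_isStabilityInterval_iff,
    fun _ _ hgap hq₁ _ hq => hgap.Uq'_eq_Vq' hq₁ hq⟩
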